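/- **Setting.** Let $1\le d\le 3$, let $D\subset\mathbb R^d$ be a bounded open set (for instance a bounded Lipschitz domain), and let $T>0$. $(\cdot,\cdot)$ and $\|\cdot\|_{L^2}$ are the inner product and norm of $L^2(D)$ (and of $L^2(D;\mathbb R^d)$), $\|u\|_{H^1}^2=\|u\|_{L^2}^2+\|\nabla u\|_{L^2}^2$, and $H^1_0(D)$ is the closure of $C_c^\infty(D)$ in $H^1(D)$. Let $F:H_0^1(D)\to L^2(D)$, $\sigma:H^1_0(D)\to H^1_0(D)$ and $K\in\mathbb R$ satisfy, for all $u,\tilde u\in H^1_0(D)$: * (A1) $F(u)\in H^1(D)$ and $\|F(u)\|_{\mathcal K}+\|\sigma(u)\|_{\mathcal K}\le K(1+\|u\|_{\mathcal K})$, both for $\mathcal K=L^2(D)$ and for $\mathcal K=H^1(D)$; * (A2) $\|F(u)-F(\tilde u)\|_{\mathcal K}+\|\sigma(u)-\sigma(\tilde u)\|_{\mathcal K}\le K\|u-\tilde u\|_{\mathcal K}$, both for $\mathcal K=L^2(D)$ and for $\mathcal K=H^1(D)$; * (A3) for $m=1,2,3$ the $m$-th Gateaux derivatives $D_u^mF(u)$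 and $D_u^m\sigma(u)$ exist as bounded $m$-linear maps from $H^1_0(D)$ to $L^2(D)$ and to $H^1_0(D)$ respectively, and the sum of their norms is at most $K$. Let $W$ be a real Wiener process with respect to a filtration $(\mathcal F_t)_{0\le t\le T}$ on a probability space $(\Omega,\mathcal F,\mathbb P)$. For $N\ge1$ put $\tau=T/N$, $t_n=n\tau$, $\overline\Delta W_n=W(t_{n+1})-W(t_n)$ and $$\widehat\Delta W_n=\tau W(t_{n+1})-\frac{\tau}{M}\sum_{\ell=1}^{M}W\Bigl(t_n+\ell\frac{\tau}{M}\Bigr),\qquad M=\lceil\tau^{-2}\rceil$$ (so that $\tau/M=\tau^3$ when $\tau^{-2}$ is an integer). Let $u_0,v_0$ be $\mathcal F_0$-measurable up to $\mathbb P$-null sets. For $\theta\in\{0,\frac12\}$, a *solution of the $\theta$-scheme* is a pair of sequences of random variables $u^n$ (with values in $H^1_0(D)$) and $v^n$ (with values in $L^2(D)$), $0\le n\le N$, both $\mathcal F_{t_n}$-measurable, with $u^0=u_0$ and $v^0=v_0$ a.s., such that $\mathbb P$-a.s. $$(u^{n+1}-u^n,\varphi)=\tau(v^{n+1},\varphi)-(\sigma(u^n)\widehat\Delta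 W_n,\varphi)\qquad\forall\varphi\in H^1_0(D),\quad 0\le n<N,$$ $$\begin{aligned}(v^{n+1}-v^n,\phi)&+\tau\bigl(\nabla[(1-\theta)u^{n+1}+\theta u^{n-1}],\nabla\phi\bigr)=\tau\bigl((1-\theta)F(u^{n+1})+\theta F(u^{n-1}),\phi\bigr)\\&+(\sigma(u^n)\overline\Delta W_n,\phi)+2\theta\bigl(D_u\sigma(u^n)v^n\,\widehat\Delta W_n,\phi\bigr)\qquad\forall\phi\in H^1_0(D),\end{aligned}$$ where the second equation is imposed for $0\le n<N$ if $\theta=0$ (the terms with $u^{n-1}$ and $D_u\sigma$ being absent) and for $1\le n<N$ if $\theta=\frac12$ (with $v^n\in H^1_0(D)$ a.s. there). If $\theta=\frac12$, the solution is moreover required to start from $$u^1=\tau v_0+u_0-\tfrac{\tau^2}{2}\Delta u_0-\tfrac{\tau^2}{2}F(u_0)-\sigma(u_0)\widehat\Delta W_0+\tau\,\sigma(u_0)\overline\Delta W_0\quad\text{a.s.}$$ Write $\delta_tu^n=(u^{n+1}-u^n)/\tau$ for $0\le n\le N-1$. **Lemma (energy stability).** There is $N_0\ge 1$, depending only on $d$,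 $D$, $T$, $K$, such that the following holds. (a) Let $\theta=0$ and $(u_0,v_0)\in L^2(\Omega;H^1_0(D)\times L^2(D))$. There is a constant $C>0$, depending only on $u_0,v_0,D,T$ and $K$, such that for every $N\ge N_0$ every solution of the scheme satisfies $$\max_{0\le n\le N-1}\mathbb E\bigl[\|\delta_tu^n\|_{L^2}^2+\|\nabla u^n\|_{L^2}^2+\|v^n\|_{L^2}^2\bigr]\le C,\qquad \max_{0\le n\le N}\mathbb E\bigl[\|\nabla u^n\|_{L^2}^2+\|v^n\|_{L^2}^2\bigr]\le C.$$ (b) Let $\theta=\frac12$, $(u_0,v_0)\in L^2(\Omega;H^1_0(D)\times H^1_0(D))$ and $\Delta u_0\in L^2(\Omega;H^1(D))$. There is a constant $C>0$, depending only on $u_0,v_0,D,T$ and $K$, such that for every $N\ge N_0$ every solution of the scheme satisfies $$\max_{0\le n\le N}\mathbb E\bigl[\|\nabla u^n\|_{L^2}^2+\|v^n\|_{L^2}^2\bigr]\le C.$$ -/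

import Mathlib

open MeasureTheory ProbabilityTheory
open scoped NNReal

noncomputable section

namespace StochWave

/-! ### Function spaces on `D ⊆ ℝ^d` -/

/-- `ℝ^d` with its Euclidean norm. -/
abbrev Rn (d : ℕ) := EuclideanSpace ℝ (Fin d)

/-- `L²(D)`. -/
abbrev L2 {d : ℕ} (D : Set (Rn d)) := Lp ℝ 2 (volume.restrict D)

/-- `L²(D; ℝ^d)`. -/
abbrev L2Vec {d : ℕ} (D : Set (Rn d)) := Lp (Rn d) 2 (volume.restrict D)

/-- Pairs `(f, g) ∈ L²(D) × L²(D; ℝ^d)` with `‖(f, g)‖² = ‖f‖² + ‖g‖²`. Elements of `H¹(D)` are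
represented by their graph `(f, ∇f)`, so that this norm is the norm of `H¹(D)`. -/
abbrev GraphSpace {d : ℕ} (D : Set (Rn d)) := WithLp 2 (L2 D × L2Vec D)

/-- Test functions `C_c^∞(D)`. -/
def IsTest {d : ℕ} (D : Set (Rn d)) (φ : Rn d → ℝ) : Prop :=
  ContDiff ℝ (⊤ : ℕ∞) φ ∧ HasCompactSupport φ ∧ tsupport φ ⊆ D

/-- `(f, g)` is (the graph of) an element of `H¹(D)`: `g` is the weak gradient of `f`. -/
def IsH1 {d : ℕ} {D : Set (Rn d)} (p : GraphSpace D) : Prop :=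
  ∀ φ : Rn d → ℝ, IsTest D φ → ∀ i : Fin d,
    ∫ x in D, p.fst x * fderiv ℝ φ x (EuclideanSpace.single i 1) = - ∫ x in D, p.snd x i * φ x

/-- `H¹₀(D)`: the closure of `C_c^∞(D)` in the norm of `H¹(D)`, with that norm. -/
def H01 {d : ℕ} (D : Set (Rn d)) : Submodule ℝ (GraphSpace D) :=
  (Submodule.span ℝ {p : GraphSpace D | ∃ φ : Rn d → ℝ, IsTest D φ ∧
    p.fst =ᵐ[volume.restrict D] φ ∧ p.snd =ᵐ[volume.restrict D] gradient φ}).topologicalClosure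

variable {d : ℕ} {D : Set (Rn d)}

/-- The embedding `H¹₀(D) → L²(D)`. -/
def toL2 (u : H01 D) : L2 D := (u : GraphSpace D).fst

/-- The weak gradient `H¹₀(D) → L²(D; ℝ^d)`. -/
def grad (u : H01 D) : L2Vec D := (u : GraphSpace D).snd

/-! ### Structure assumptions on `F : H¹₀(D) → L²(D)` and `σ : H¹₀(D) → H¹₀(D)` -/

/-- Linear growth in `L²(D)` and in `H¹(D)` (in particular `F u ∈ H¹(D)`). -/
structure LinearGrowth (F : H01 D → L2 D) (σ : H01 D → H01 D) (K : ℝ) : Prop where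
  inL2 : ∀ u, ‖F u‖ + ‖toL2 (σ u)‖ ≤ K * (1 + ‖toL2 u‖)
  inH1 : ∀ u, ∃ p : GraphSpace D, IsH1 p ∧ p.fst = F u ∧ ‖p‖ + ‖σ u‖ ≤ K * (1 + ‖u‖)

/-- Lipschitz continuity in `L²(D)` and in `H¹(D)`. -/
structure LipschitzBound (F : H01 D → L2 D) (σ : H01 D → H01 D) (K : ℝ) : Prop where
  inL2 : ∀ u w, ‖F u - F w‖ + ‖toL2 (σ u) - toL2 (σ w)‖ ≤ K * ‖toL2 u - toL2 w‖
  inH1 : ∀ u w, ∃ p : GraphSpace D, IsH1 p ∧ p.fst = F u - F w ∧ ‖p‖ + ‖σ u - σ w‖ ≤ K * ‖u - w‖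

/-- `p m u` is, for `m ≤ r`, the `m`-th Gateaux derivative of `f` at `u`, a bounded `m`-linear
map: `p 0 = f`, and `p (m + 1) u (ξ, η₁, …, η_m)` is the directional derivative at `u` in the
direction `ξ` of `w ↦ p m w (η₁, …, η_m)`. -/
structure HasGateauxSeries {X Y : Type*} [NormedAddCommGroup X] [NormedSpace ℝ X]
    [NormedAddCommGroup Y] [NormedSpace ℝ Y] (r : ℕ) (f : X → Y)
    (p : (m : ℕ) → X → ContinuousMultilinearMap ℝ (fun _ : Fin m => X) Y) : Prop where
  zero : ∀ u η, p 0 u η = f u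
  succ : ∀ m < r, ∀ (u ξ : X) (η : Fin m → X),
    HasLineDerivAt ℝ (fun w => p m w η) (p (m + 1) u (Fin.cons ξ η)) u ξ

/-- The Gateaux derivatives of orders `1, 2, 3` of `F` and `σ` exist and are bounded. -/
def BoundedDerivatives (F : H01 D → L2 D) (σ : H01 D → H01 D) (K : ℝ) : Prop :=
  ∃ p q, HasGateauxSeries 3 F p ∧ HasGateauxSeries 3 σ q ∧
    ∀ m, 1 ≤ m → m ≤ 3 → ∀ u, ‖p m u‖ + ‖q m u‖ ≤ K

/-! ### The Wiener process and its increments -/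

variable {Ω : Type*} {mΩ : MeasurableSpace Ω}

/-- `W` is a real Wiener process with respect to the filtration `(𝓕 t)` for `0 ≤ t ≤ T`. -/
structure IsWiener (T : ℝ≥0) (𝓕 : Filtration ℝ≥0 mΩ) (W : ℝ≥0 → Ω → ℝ) (P : Measure Ω) :
    Prop where
  brownian : IsBrownianReal W P
  adapted : ∀ t ≤ T, StronglyMeasurable[𝓕 t] (W t)
  indep : ∀ s t, s ≤ t → t ≤ T →
    Indep (𝓕 s) (MeasurableSpace.comap (fun ω => W t ω - W s ω) inferInstance) P

/-- The mesh size `τ = T / N`. -/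
def tau (T : ℝ≥0) (N : ℕ) : ℝ≥0 := T / N

/-- The time nodes `t_n = n τ`. -/
def node (T : ℝ≥0) (N n : ℕ) : ℝ≥0 := n * tau T N

/-- `W(t_{n+1}) - W(t_n)`. -/
def incr (W : ℝ≥0 → Ω → ℝ) (T : ℝ≥0) (N n : ℕ) (ω : Ω) : ℝ :=
  W (node T N (n + 1)) ω - W (node T N n) ω

/-- The number `M` of subintervals of `[t_n, t_{n+1}]`: `τ⁻²`, rounded up if it is not an
integer. -/
def subdiv (T : ℝ≥0) (N : ℕ) : ℕ := ⌈((tau T N) ^ 2)⁻¹⌉₊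

/-- `τ W(t_{n+1}) - (τ / M) ∑_{ℓ=1}^{M} W(t_n + ℓ τ / M)` with `M = subdiv T N`. If `τ⁻²` is an
integer, then `M = τ⁻²` and `τ / M = τ³`. -/
def hatIncr (W : ℝ≥0 → Ω → ℝ) (T : ℝ≥0) (N n : ℕ) (ω : Ω) : ℝ :=
  tau T N * W (node T N (n + 1)) ω - (tau T N / subdiv T N : ℝ≥0) *
    ∑ l ∈ Finset.Icc 1 (subdiv T N), W (node T N n + l * (tau T N / subdiv T N)) ω

/-! ### The `θ`-scheme -/

/-- First equation of one time step: from `u` to `(u', v')`, with noise `hW`. -/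
def FirstEq (τ : ℝ) (σ : H01 D → H01 D) (hW : ℝ) (u u' : H01 D) (v' : L2 D) : Prop :=
  ∀ φ : H01 D, inner ℝ (toL2 u' - toL2 u) (toL2 φ) =
    τ * inner ℝ v' (toL2 φ) - inner ℝ (hW • toL2 (σ u)) (toL2 φ)

/-- Second equation of one time step: from `(uprev, u, v)` to `(u', v')`, with noises `dW`, `hW`.
`w` is `v` as an element of `H¹₀(D)`, where the derivative of `σ` acts; it is needed only if
`θ ≠ 0`. -/
def SecondEq (θ τ : ℝ) (F : H01 D → L2 D) (σ : H01 D → H01 D) (dW hW : ℝ)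
    (uprev u u' : H01 D) (v v' : L2 D) : Prop :=
  ∃ w : H01 D, (θ ≠ 0 → toL2 w = v) ∧ ∀ φ : H01 D,
    inner ℝ (v' - v) (toL2 φ) + τ * inner ℝ ((1 - θ) • grad u' + θ • grad uprev) (grad φ) =
      τ * inner ℝ ((1 - θ) • F u' + θ • F uprev) (toL2 φ) + inner ℝ (dW • toL2 (σ u)) (toL2 φ)
        + 2 * θ * inner ℝ (hW • toL2 (lineDeriv ℝ σ u w)) (toL2 φ)

/-- `(u n, v n)`, `0 ≤ n ≤ N`, is an adapted solution of the `θ`-scheme on `[0, T]` with initial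
data `(u₀, v₀)`. The second equation is imposed from the step `n = n₀` on; for `n = 0` the value
`u (n - 1)` is multiplied by `θ`, and `n₀ = 0` is used with `θ = 0` only. -/
structure IsThetaScheme (θ : ℝ) (n₀ : ℕ) (T : ℝ≥0) (N : ℕ) (F : H01 D → L2 D) (σ : H01 D → H01 D)
    (𝓕 : Filtration ℝ≥0 mΩ) (W : ℝ≥0 → Ω → ℝ) (P : Measure Ω) (u₀ : Ω → H01 D) (v₀ : Ω → L2 D)
    (u : ℕ → Ω → H01 D) (v : ℕ → Ω → L2 D) : Prop where
  adapted_u : ∀ n ≤ N, StronglyMeasurable[𝓕 (node T N n)] (u n)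
  adapted_v : ∀ n ≤ N, StronglyMeasurable[𝓕 (node T N n)] (v n)
  init_u : u 0 =ᵐ[P] u₀
  init_v : v 0 =ᵐ[P] v₀
  first : ∀ n < N, ∀ᵐ ω ∂P,
    FirstEq (tau T N) σ (hatIncr W T N n ω) (u n ω) (u (n + 1) ω) (v (n + 1) ω)
  second : ∀ n, n₀ ≤ n → n < N → ∀ᵐ ω ∂P,
    SecondEq θ (tau T N) F σ (incr W T N n ω) (hatIncr W T N n ω)
      (u (n - 1) ω) (u n ω) (u (n + 1) ω) (v n ω) (v (n + 1) ω)

/-- The starting value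
`u¹ = τ v₀ + u₀ - τ²/2 Δu₀ - τ²/2 F(u₀) - σ(u₀) hW + τ σ(u₀) dW` of the scheme with `θ = 1/2`,
where `Lu` is `Δu₀`. -/
def StartingValue (τ : ℝ) (F : H01 D → L2 D) (σ : H01 D → H01 D) (dW hW : ℝ)
    (u₀ v₀ : H01 D) (Lu : L2 D) (u₁ : H01 D) : Prop :=
  toL2 u₁ = τ • toL2 v₀ + toL2 u₀ - (τ ^ 2 / 2) • Lu - (τ ^ 2 / 2) • F u₀
    - hW • toL2 (σ u₀) + (τ * dW) • toL2 (σ u₀)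

/-- `f = Δu` in the weak sense. -/
def IsWeakLaplacian (u : H01 D) (f : L2 D) : Prop :=
  ∀ φ : H01 D, inner ℝ (grad u) (grad φ) = - inner ℝ f (toL2 φ)

/-- `E[X] ≤ C` for a nonnegative random variable `X`, integrability included. -/
def ExpectLE (P : Measure Ω) (X : Ω → ℝ) (C : ℝ) : Prop :=
  Integrable X P ∧ ∫ ω, X ω ∂P ≤ C

end StochWave

end

open StochWave

/-!
The proof is an energy argument in the full norm of `H¹₀(D)`, so that no Poincaré inequality is
needed. By density of the test functions in `L²(D)` the first equation identifies `v (n + 1)` with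
an element of `H¹₀(D)` (`FirstEq.toL2_eq`), which may then serve as test function in the second
equation.

For `θ = 0`, testing with `v (n + 1)` gives a recursion for `‖v n‖² + ‖u n‖²`
(`energy_step_zero`). The squares of the increments generated by the implicit discretization absorb
the noise terms that are not adapted; the remaining ones have mean zero or are quadratic in the
noise. For `θ = 1/2` the test function is `v (n + 1) + v n` and the energy is
`2 ‖v n‖² + ‖u n‖² + ‖u (n - 1)‖²` (`energy_step_half`). The increments are not controlled here. The
noise `hatIncr` has variance at most `τ ^ 3`, so that its square may be divided by `τ`, and Young's
inequality suffices for it. The one critical term contains `v (n + 1) - v n` multiplied by `incr`;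
it is rewritten by testing the second equation with `σ (u n)`. The derivative of `σ` enters only
through its bound in `L²(D)`, which follows from the Lipschitz condition
(`norm_toL2_lineDeriv_le`).

The two noises enter the expectations only through `IsNoise`: against integrable weights measurable
with respect to the past, their integral vanishes and their square is bounded by the variance.
`hatIncr` is a mean of increments of `W` over intervals beginning after `t_n`
(`hatIncr_eq`), so that this needs the independence of single increments only. Integrability of the
energies is obtained along the way, from the pathwise inequalities (`expectation_step`). A discrete
Gronwall inequality concludes.

For `θ = 1/2` the first energy is computed from the starting value. That value is prescribed in
`L²(D)`, and uniqueness of weak gradients (`H1_ext`) makes its `H¹(D)` norm accessible.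
-/

namespace StochWave

/-! ### Test functions and weak gradients -/

section FunctionSpaces

variable {d : ℕ} {D : Set (Rn d)}

/-- The embedding `toL2 : H¹₀(D) → L²(D)` as a continuous linear map. -/
noncomputable def toL2L (D : Set (Rn d)) : H01 D →L[ℝ] L2 D :=
  (WithLp.fstL 2 ℝ (L2 D) (L2Vec D)).comp (H01 D).subtypeL

lemma toL2L_apply (u : H01 D) : toL2L D u = toL2 u := rfl

lemma inner_H01 (u w : H01 D) :
    inner ℝ u w = inner ℝ (toL2 u) (toL2 w) + inner ℝ (grad u) (grad w) :=
  WithLp.prod_inner_apply (u : GraphSpace D) (w : GraphSpace D)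

lemma norm_sq_H01 (u : H01 D) : ‖u‖ ^ 2 = ‖toL2 u‖ ^ 2 + ‖grad u‖ ^ 2 :=
  WithLp.prod_norm_sq_eq_of_L2 (u : GraphSpace D)

lemma norm_toL2L_le (u : H01 D) : ‖toL2L D u‖ ≤ ‖u‖ := by
  have h := norm_sq_H01 u
  rw [toL2L_apply]
  exact le_of_sq_le_sq (by nlinarith [sq_nonneg ‖grad u‖]) (norm_nonneg u)

lemma continuous_grad : Continuous (grad : H01 D → L2Vec D) :=
  ((WithLp.sndL 2 ℝ (L2 D) (L2Vec D)).comp (H01 D).subtypeL).continuous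

lemma IsTest.memLp {φ : Rn d → ℝ} (hφ : IsTest D φ) :
    MemLp φ 2 (volume.restrict D) :=
  hφ.1.continuous.memLp_of_hasCompactSupport hφ.2.1

lemma IsTest.continuous_fderiv {φ : Rn d → ℝ} (hφ : IsTest D φ) : Continuous (fderiv ℝ φ) :=
  hφ.1.continuous_fderiv (by simp)

lemma IsTest.memLp_fderiv_apply {φ : Rn d → ℝ} (hφ : IsTest D φ) (e : Rn d) :
    MemLp (fun x => fderiv ℝ φ x e) 2 (volume.restrict D) :=
  (hφ.continuous_fderiv.clm_apply continuous_const).memLp_of_hasCompactSupport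
    (hφ.2.1.fderiv_apply ℝ e)

lemma IsTest.memLp_gradient {φ : Rn d → ℝ} (hφ : IsTest D φ) :
    MemLp (gradient φ) 2 (volume.restrict D) := by
  have hc : Continuous (gradient φ) :=
    (InnerProductSpace.toDual ℝ (Rn d)).symm.continuous.comp hφ.continuous_fderiv
  refine hc.memLp_of_hasCompactSupport ?_
  exact (hφ.2.1.fderiv ℝ).comp_left (g := (InnerProductSpace.toDual ℝ (Rn d)).symm) (by simp)

lemma IsTest.memLp_smul_single {φ : Rn d → ℝ} (hφ : IsTest D φ) (i : Fin d) :
    MemLp (fun x => φ x • (EuclideanSpace.single i 1 : Rn d)) 2 (volume.restrict D) :=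
  (hφ.1.continuous.smul continuous_const).memLp_of_hasCompactSupport hφ.2.1.smul_right

/-- The element of `H¹₀(D)` given by a test function. -/
noncomputable def IsTest.toH01 {φ : Rn d → ℝ} (hφ : IsTest D φ) : H01 D :=
  ⟨WithLp.toLp 2 (hφ.memLp.toLp φ, hφ.memLp_gradient.toLp (gradient φ)),
    Submodule.le_topologicalClosure _ (Submodule.subset_span
      ⟨φ, hφ, hφ.memLp.coeFn_toLp, hφ.memLp_gradient.coeFn_toLp⟩)⟩

lemma IsTest.toL2_toH01 {φ : Rn d → ℝ} (hφ : IsTest D φ) : toL2 hφ.toH01 = hφ.memLp.toLp φ := rfl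

lemma inner_toLp_right (f : L2 D) {g : Rn d → ℝ} (hg : MemLp g 2 (volume.restrict D)) :
    inner ℝ f (hg.toLp g) = ∫ x in D, f x * g x := by
  rw [L2.inner_def]
  refine integral_congr_ae ?_
  filter_upwards [hg.coeFn_toLp] with x hx
  rw [hx]
  simp [mul_comm]

lemma inner_toLp_smul_single (f : L2Vec D) {φ : Rn d → ℝ} (hφ : IsTest D φ) (i : Fin d) :
    inner ℝ f ((hφ.memLp_smul_single i).toLp _) = ∫ x in D, f x i * φ x := by
  rw [L2.inner_def]
  refine integral_congr_ae ?_
  filter_upwards [(hφ.memLp_smul_single i).coeFn_toLp] with x hx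
  rw [hx, inner_smul_right, EuclideanSpace.inner_single_right]
  simp [mul_comm]

/-- Being a weak gradient, as the vanishing of a family of bounded linear functionals. -/
lemma isH1_iff (p : GraphSpace D) : IsH1 p ↔ ∀ (φ : Rn d → ℝ) (hφ : IsTest D φ) (i : Fin d),
    inner ℝ p.fst ((hφ.memLp_fderiv_apply (EuclideanSpace.single i 1)).toLp _)
      + inner ℝ p.snd ((hφ.memLp_smul_single i).toLp _) = 0 := by
  refine forall_congr' fun φ => forall_congr' fun hφ => forall_congr' fun i => ?_
  rw [inner_toLp_right, inner_toLp_smul_single _ hφ, add_eq_zero_iff_eq_neg]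

/-- `H¹(D)` as a subspace of pairs. -/
def H1 (D : Set (Rn d)) : Submodule ℝ (GraphSpace D) where
  carrier := {p | IsH1 p}
  add_mem' := by
    intro p q hp hq
    rw [Set.mem_ofPred_eq, isH1_iff] at *
    intro φ hφ i
    rw [WithLp.add_fst, WithLp.add_snd, inner_add_left, inner_add_left]
    linarith [hp φ hφ i, hq φ hφ i]
  zero_mem' := by
    rw [Set.mem_ofPred_eq, isH1_iff]
    intro φ hφ i
    simp
  smul_mem' := by
    intro c p hp
    rw [Set.mem_ofPred_eq, isH1_iff] at *
    intro φ hφ i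
    rw [WithLp.smul_fst, WithLp.smul_snd, real_inner_smul_left, real_inner_smul_left, ← mul_add,
      hp φ hφ i, mul_zero]

lemma mem_H1 {p : GraphSpace D} : p ∈ H1 D ↔ IsH1 p := Iff.rfl

lemma isClosed_H1 : IsClosed (H1 D : Set (GraphSpace D)) := by
  have : (H1 D : Set (GraphSpace D)) = ⋂ (φ : Rn d → ℝ) (hφ : IsTest D φ) (i : Fin d),
      {p | inner ℝ p.fst ((hφ.memLp_fderiv_apply (EuclideanSpace.single i 1)).toLp _)
        + inner ℝ p.snd ((hφ.memLp_smul_single i).toLp _) = 0} := by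
    ext p
    simp only [SetLike.mem_coe, mem_H1, isH1_iff, Set.mem_iInter, Set.mem_ofPred_eq]
  rw [this]
  refine isClosed_iInter fun φ => isClosed_iInter fun hφ => isClosed_iInter fun i => ?_
  have h1 : Continuous fun p : GraphSpace D => p.fst :=
    (WithLp.fstL 2 ℝ (L2 D) (L2Vec D)).continuous
  have h2 : Continuous fun p : GraphSpace D => p.snd :=
    (WithLp.sndL 2 ℝ (L2 D) (L2Vec D)).continuous
  exact isClosed_eq (by fun_prop) continuous_const

/-- Integration by parts for two test functions on `D`. -/
lemma IsTest.integral_by_parts {ψ φ : Rn d → ℝ} (hψ : IsTest D ψ) (hφ : IsTest D φ) (e : Rn d) :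
    ∫ x in D, ψ x * fderiv ℝ φ x e = - ∫ x in D, fderiv ℝ ψ x e * φ x := by
  have hsub : ∀ {χ : Rn d → ℝ}, IsTest D χ → ∀ x, x ∉ D → χ x = 0 := fun hχ x hx =>
    image_eq_zero_of_notMem_tsupport fun h => hx (hχ.2.2 h)
  rw [setIntegral_eq_integral_of_forall_compl_eq_zero fun x hx => by rw [hsub hψ x hx, zero_mul],
    setIntegral_eq_integral_of_forall_compl_eq_zero fun x hx => by rw [hsub hφ x hx, mul_zero]]
  have cψ := hψ.1.continuous
  have cφ := hφ.1.continuous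
  have dψ := hψ.continuous_fderiv.clm_apply (continuous_const (y := e))
  have dφ := hφ.continuous_fderiv.clm_apply (continuous_const (y := e))
  refine integral_mul_fderiv_eq_neg_fderiv_mul_of_integrable
    ((dψ.mul cφ).integrable_of_hasCompactSupport hφ.2.1.mul_left)
    ((cψ.mul dφ).integrable_of_hasCompactSupport hψ.2.1.mul_right)
    ((cψ.mul cφ).integrable_of_hasCompactSupport hφ.2.1.mul_left)
    (fun x _ => (hψ.1.differentiable (by simp)) x) (fun x _ => (hφ.1.differentiable (by simp)) x)

lemma H01_le_H1 : H01 D ≤ H1 D := by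
  refine Submodule.topologicalClosure_minimal _ (Submodule.span_le.2 ?_) isClosed_H1
  rintro p ⟨ψ, hψ, h1, h2⟩ φ hφ i
  calc ∫ x in D, p.fst x * fderiv ℝ φ x (EuclideanSpace.single i 1)
      = ∫ x in D, ψ x * fderiv ℝ φ x (EuclideanSpace.single i 1) :=
        integral_congr_ae (by filter_upwards [h1] with x hx; rw [hx])
    _ = - ∫ x in D, fderiv ℝ ψ x (EuclideanSpace.single i 1) * φ x := hψ.integral_by_parts hφ _
    _ = - ∫ x in D, p.snd x i * φ x := by
        congr 1
        refine integral_congr_ae ?_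
        filter_upwards [h2] with x hx
        rw [hx, ← inner_gradient_left, EuclideanSpace.inner_single_right]
        simp

/-- A function in `L²(D)` that vanishes against all test functions is zero. -/
lemma ae_eq_zero_of_forall_test (hD : IsOpen D) {f : Rn d → ℝ} (hf : MemLp f 2 (volume.restrict D))
    (h : ∀ φ, IsTest D φ → ∫ x in D, f x * φ x = 0) : f =ᵐ[volume.restrict D] 0 := by
  have hloc : LocallyIntegrableOn f D := by
    rw [locallyIntegrableOn_iff hD.isLocallyClosed]
    intro k hkD hk
    have := hf.locallyIntegrable (by norm_num : (1 : ENNReal) ≤ 2)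
    have h2 := this.integrableOn_isCompact hk
    rwa [IntegrableOn, Measure.restrict_restrict_of_subset hkD] at h2
  have := hD.ae_eq_zero_of_integral_contDiff_smul_eq_zero hloc fun g hg1 hg2 hg3 => by
    rw [← h g ⟨hg1, hg2, hg3⟩, setIntegral_eq_integral_of_forall_compl_eq_zero]
    · simp [mul_comm]
    · intro x hx
      rw [image_eq_zero_of_notMem_tsupport fun h => hx (hg3 h), mul_zero]
  exact (ae_restrict_iff' hD.measurableSet).2 this

/-- The image of `H¹₀(D)` in `L²(D)` is dense, since only `0` is orthogonal to it. -/
lemma eq_zero_of_forall_inner_toL2 (hD : IsOpen D) {z : L2 D}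
    (h : ∀ φ : H01 D, inner ℝ z (toL2 φ) = 0) : z = 0 := by
  rw [Lp.eq_zero_iff_ae_eq_zero]
  refine ae_eq_zero_of_forall_test hD (Lp.memLp z) fun φ hφ => ?_
  rw [← h hφ.toH01, hφ.toL2_toH01, inner_toLp_right]

/-- The weak gradient is unique. -/
lemma H1_ext (hD : IsOpen D) {p q : GraphSpace D} (hp : p ∈ H1 D) (hq : q ∈ H1 D)
    (h : p.fst = q.fst) : p = q := by
  have hr : p - q ∈ H1 D := (H1 D).sub_mem hp hq
  have h1 : (p - q).fst = 0 := by rw [WithLp.sub_fst, h, sub_self]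
  have h2 : (p - q).snd = 0 := by
    rw [Lp.eq_zero_iff_ae_eq_zero]
    have hi : ∀ i : Fin d, (fun x => (p - q).snd x i) =ᵐ[volume.restrict D] 0 := fun i => by
      refine ae_eq_zero_of_forall_test hD ?_ fun φ hφ => ?_
      · exact (EuclideanSpace.proj (𝕜 := ℝ) i).comp_memLp' (Lp.memLp (p - q).snd)
      · have := (isH1_iff _).1 hr φ hφ i
        rw [h1, inner_zero_left, zero_add, inner_toLp_smul_single _ hφ] at this
        exact this
    filter_upwards [ae_all_iff.2 hi] with x hx
    ext i
    exact hx i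
  have : p - q = 0 := by
    exact WithLp.ofLp_injective 2 (Prod.ext h1 h2)
  exact sub_eq_zero.1 this

/-- The first equation of the scheme exhibits `v'` as an element of `H¹₀(D)`. -/
lemma FirstEq.toL2_eq (hD : IsOpen D) {τ hW : ℝ} (hτ : 0 < τ) {σ : H01 D → H01 D} {u u' : H01 D}
    {v' : L2 D} (h : FirstEq τ σ hW u u' v') :
    toL2 (τ⁻¹ • (u' - u + hW • σ u)) = v' := by
  have h0 : toL2 u' - toL2 u - τ • v' + hW • toL2 (σ u) = 0 := by
    refine eq_zero_of_forall_inner_toL2 hD fun φ => ?_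
    rw [inner_add_left, inner_sub_left _ (τ • v'), h φ, real_inner_smul_left v']
    ring
  have h1 : toL2 (τ⁻¹ • (u' - u + hW • σ u)) = τ⁻¹ • (toL2 u' - toL2 u + hW • toL2 (σ u)) := by
    simp only [← toL2L_apply, map_smul, map_add, map_sub]
  have h2 : toL2 u' - toL2 u + hW • toL2 (σ u) = τ • v' := by
    rw [← sub_eq_zero, ← h0]; abel
  rw [h1, h2, smul_smul, inv_mul_cancel₀ hτ.ne', one_smul]

/-- The Lipschitz bound in `L²(D)` bounds the directional derivatives of `σ` in `L²(D)`. -/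
lemma norm_toL2_lineDeriv_le {σ : H01 D → H01 D} {K : ℝ} (hK : 0 ≤ K)
    (hσ : ∀ u w, ‖toL2 (σ u) - toL2 (σ w)‖ ≤ K * ‖toL2 u - toL2 w‖) (u w : H01 D) :
    ‖toL2 (lineDeriv ℝ σ u w)‖ ≤ K * ‖toL2 w‖ := by
  by_cases hd : LineDifferentiableAt ℝ σ u w
  · have h1 : HasDerivAt (fun t : ℝ => toL2L D (σ (u + t • w))) (toL2L D (lineDeriv ℝ σ u w)) 0 :=
      (toL2L D).hasFDerivAt.comp_hasDerivAt (0 : ℝ) hd.hasLineDerivAt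
    refine h1.le_of_lip' (by positivity) (Filter.Eventually.of_forall fun t => ?_)
    refine (hσ _ _).trans (le_of_eq ?_)
    simp only [← toL2L_apply, ← map_sub]
    simp only [zero_smul, add_zero, add_sub_cancel_left, map_smul, norm_smul, sub_zero]
    ring
  · rw [lineDeriv_zero_of_not_lineDifferentiableAt hd, ← toL2L_apply, map_zero, norm_zero]
    positivity

end FunctionSpaces

/-! ### Energy inequalities for one time step -/

section Energy

variable {X Y : Type*} [NormedAddCommGroup X] [InnerProductSpace ℝ X]
  [NormedAddCommGroup Y] [InnerProductSpace ℝ Y]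

/-- Weighted Young inequality for an inner product. -/
lemma two_mul_inner_le (c : ℝ) (hc : 0 < c) (h : ℝ) (x y : X) :
    2 * (h * inner ℝ x y) ≤ c * ‖x‖ ^ 2 + h ^ 2 / c * ‖y‖ ^ 2 := by
  have h1 := real_inner_le_norm x (h • y)
  rw [real_inner_smul_right, norm_smul, Real.norm_eq_abs] at h1
  have h2 : (‖x‖ * c - |h| * ‖y‖) ^ 2 / c = c * ‖x‖ ^ 2 - 2 * (‖x‖ * (|h| * ‖y‖))
      + h ^ 2 / c * ‖y‖ ^ 2 := by
    rw [← sq_abs h]; field_simp; ring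
  have h3 : 0 ≤ (‖x‖ * c - |h| * ‖y‖) ^ 2 / c := by positivity
  linarith

lemma neg_two_mul_inner_le (c : ℝ) (hc : 0 < c) (h : ℝ) (x y : X) :
    -(2 * (h * inner ℝ x y)) ≤ c * ‖x‖ ^ 2 + h ^ 2 / c * ‖y‖ ^ 2 := by
  have := two_mul_inner_le c hc (-h) x y
  rw [neg_sq] at this
  linarith

lemma norm_add_sq_le_two (x y : X) : ‖x + y‖ ^ 2 ≤ 2 * ‖x‖ ^ 2 + 2 * ‖y‖ ^ 2 := by
  have h1 := norm_add_sq_real x y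
  have h2 := norm_sub_sq_real x y
  nlinarith [sq_nonneg ‖x - y‖]

/-- One step of the implicit scheme (`θ = 0`). The squares of the increments `u' - u` and `v' - v`
produced by the implicit discretization absorb the parts of the noise terms that are not
adapted. -/
lemma energy_step_zero (J : X →L[ℝ] Y) (hJ : ∀ x, ‖J x‖ ≤ ‖x‖) {τ A dW h : ℝ} (hτ : 0 < τ)
    (hA : 1 ≤ A) {u u' w' s : X} {v f : Y} (hw : τ • w' = u' - u + h • s)
    (hs : ‖s‖ ^ 2 ≤ A * (1 + ‖u‖ ^ 2)) (hf : ‖f‖ ^ 2 ≤ A * (1 + ‖u'‖ ^ 2))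
    (heq : ∀ φ : X, inner ℝ (J w' - v) (J φ) + τ * inner ℝ u' φ =
      τ * inner ℝ (f + J u') (J φ) + dW * inner ℝ (J s) (J φ)) :
    ‖J w'‖ ^ 2 + ‖u'‖ ^ 2 ≤ ‖v‖ ^ 2 + ‖u‖ ^ 2 - 2 * (h * inner ℝ u s) + 2 * (dW * inner ℝ (J s) v)
      + A * (h ^ 2 + dW ^ 2) * (1 + ‖u‖ ^ 2) + 5 * A * τ * (1 + ‖J w'‖ ^ 2 + ‖u'‖ ^ 2) := by
  have e0 := heq w'
  have e1 : τ * inner ℝ u' w' = inner ℝ u' (u' - u) + h * inner ℝ u' s := by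
    rw [← real_inner_smul_right, hw, inner_add_right, real_inner_smul_right]
  set v' := J w'
  have e2 : 2 * inner ℝ u' (u' - u) = ‖u'‖ ^ 2 - ‖u‖ ^ 2 + ‖u' - u‖ ^ 2 := by
    rw [norm_sub_sq_real, inner_sub_right, real_inner_self_eq_norm_sq]; ring
  have e3 : 2 * inner ℝ (v' - v) v' = ‖v'‖ ^ 2 - ‖v‖ ^ 2 + ‖v' - v‖ ^ 2 := by
    rw [norm_sub_sq_real, inner_sub_left, real_inner_self_eq_norm_sq, real_inner_comm]; ring
  have e4 : inner ℝ u' s = inner ℝ u s + inner ℝ (u' - u) s := by rw [inner_sub_left]; ring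
  have e5 : inner ℝ (J s) v' = inner ℝ (J s) v + inner ℝ (v' - v) (J s) := by
    rw [real_inner_comm (J s) (v' - v), inner_sub_right]; ring
  -- weight `1`: these are the terms absorbed by `‖u' - u‖²` and `‖v' - v‖²`
  have b1 := neg_two_mul_inner_le 1 one_pos h (u' - u) s
  have b2 := two_mul_inner_le 1 one_pos dW (v' - v) (J s)
  have b3 := two_mul_inner_le 1 one_pos 1 (f + J u') v'
  have b4 := norm_add_sq_le_two f (J u')
  have b5 : ‖J u'‖ ^ 2 ≤ ‖u'‖ ^ 2 := pow_le_pow_left₀ (norm_nonneg _) (hJ _) 2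
  have b6 : ‖J s‖ ^ 2 ≤ ‖s‖ ^ 2 := pow_le_pow_left₀ (norm_nonneg _) (hJ _) 2
  rw [e1, e4, e5] at e0
  norm_num at b1 b2 b3
  have b7 : (h ^ 2 + dW ^ 2) * ‖s‖ ^ 2 ≤ (h ^ 2 + dW ^ 2) * (A * (1 + ‖u‖ ^ 2)) := by gcongr
  have b8 : dW ^ 2 * ‖J s‖ ^ 2 ≤ dW ^ 2 * ‖s‖ ^ 2 := by gcongr
  have b9 : 2 * inner ℝ (f + J u') v' ≤ 5 * A * (1 + ‖v'‖ ^ 2 + ‖u'‖ ^ 2) := by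
    nlinarith [sq_nonneg ‖u'‖, sq_nonneg ‖v'‖]
  have b10 := mul_le_mul_of_nonneg_left b9 hτ.le
  nlinarith

/-- One step of the scheme with `θ = 1/2`; `um`, `u`, `u'` are three consecutive values, `s`, `sm`
the values of `σ` at `u`, `um`, and `Dv` is the derivative of `σ` at `u` applied to `v`. There is no
numerical dissipation. The equation is tested with `v' + v`; the noise term containing `v' - v` is
rewritten by testing the equation with `s` itself. -/
lemma energy_step_half (J : X →L[ℝ] Y) (hJ : ∀ x, ‖J x‖ ≤ ‖x‖) {τ A dW h hm : ℝ} (hτ : 0 < τ)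
    (hτ1 : τ ≤ 1) (hA : 1 ≤ A) {um u u' w w' s sm : X} {f fm Dv : Y}
    (hw : τ • w = u - um + hm • sm) (hw' : τ • w' = u' - u + h • s)
    (hs : ‖s‖ ^ 2 ≤ A * (1 + ‖u‖ ^ 2)) (hsm : ‖sm‖ ^ 2 ≤ A * (1 + ‖um‖ ^ 2))
    (hf : ‖f‖ ^ 2 ≤ A * (1 + ‖u'‖ ^ 2)) (hfm : ‖fm‖ ^ 2 ≤ A * (1 + ‖um‖ ^ 2))
    (hDv : ‖Dv‖ ^ 2 ≤ A * ‖J w‖ ^ 2)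
    (heq : ∀ φ : X, inner ℝ (J w' - J w) (J φ) + τ / 2 * inner ℝ (u' + um) φ =
      τ / 2 * inner ℝ (f + fm + J (u' + um)) (J φ) + dW * inner ℝ (J s) (J φ)
        + h * inner ℝ Dv (J φ)) :
    2 * ‖J w'‖ ^ 2 + ‖u'‖ ^ 2 + ‖u‖ ^ 2 ≤ 2 * ‖J w‖ ^ 2 + ‖u‖ ^ 2 + ‖um‖ ^ 2
      + 4 * (dW * inner ℝ (J s) (J w))
      + A * (1 + (2 * ‖J w‖ ^ 2 + ‖u‖ ^ 2 + ‖um‖ ^ 2)) * (3 * (h ^ 2 / τ) + 4 * dW ^ 2)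
      + A * (1 + ‖um‖ ^ 2) * (hm ^ 2 / τ)
      + 15 * A * τ * (2 + (2 * ‖J w‖ ^ 2 + ‖u‖ ^ 2 + ‖um‖ ^ 2)
          + (2 * ‖J w'‖ ^ 2 + ‖u'‖ ^ 2 + ‖u‖ ^ 2)) := by
  set v := J w
  set v' := J w'
  set G := f + fm + J (u' + um)
  set B := 1 + (2 * ‖v‖ ^ 2 + ‖u‖ ^ 2 + ‖um‖ ^ 2) with hB
  set B' := 1 + (2 * ‖v'‖ ^ 2 + ‖u'‖ ^ 2 + ‖u‖ ^ 2) with hB'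
  have B0 : 0 ≤ B := by positivity
  have B0' : 0 ≤ B' := by positivity
  have A0 : 0 ≤ A := by linarith
  have hq : 0 ≤ h ^ 2 / τ := by positivity
  have hq2 : h ^ 2 ≤ h ^ 2 / τ := by
    rw [le_div_iff₀ hτ]; nlinarith [sq_nonneg h]
  -- the two tests of the equation
  have e0 := heq (w' + w)
  have e1 := heq s
  have e2 : τ * inner ℝ (u' + um) (w' + w) = ‖u'‖ ^ 2 - ‖um‖ ^ 2
      + h * inner ℝ (u' + um) s + hm * inner ℝ (u' + um) sm := by
    rw [← real_inner_smul_right, smul_add, hw, hw']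
    have : u' - u + h • s + (u - um + hm • sm) = (u' - um) + h • s + hm • sm := by abel
    rw [this, inner_add_right, inner_add_right, real_inner_smul_right, real_inner_smul_right,
      inner_add_left, inner_sub_right, inner_sub_right, real_inner_comm um u',
      real_inner_self_eq_norm_sq, real_inner_self_eq_norm_sq]
    ring
  have e3 : inner ℝ (v' - v) (v' + v) = ‖v'‖ ^ 2 - ‖v‖ ^ 2 := by
    rw [inner_sub_left, inner_add_right, inner_add_right, real_inner_comm v v',
      real_inner_self_eq_norm_sq, real_inner_self_eq_norm_sq]
    ring
  have e4 : inner ℝ (J s) (v' + v) = 2 * inner ℝ (J s) v + inner ℝ (v' - v) (J s) := by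
    rw [real_inner_comm (J s) (v' - v), inner_sub_right, inner_add_right]; ring
  rw [map_add, e3, e4] at e0
  rw [real_inner_self_eq_norm_sq] at e1
  -- twice the first test, with `v' - v` in the noise term eliminated by the second test
  have key : 2 * ‖v'‖ ^ 2 + ‖u'‖ ^ 2 - (2 * ‖v‖ ^ 2 + ‖um‖ ^ 2) = 4 * (dW * inner ℝ (J s) v)
      + (-(h * inner ℝ (u' + um) s)) + (-(hm * inner ℝ (u' + um) sm))
      + τ * inner ℝ G (v' + v) + τ * (-(dW * inner ℝ (u' + um) s)) + τ * (dW * inner ℝ G (J s))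
      + 2 * (dW ^ 2 * ‖J s‖ ^ 2) + 2 * (h * (dW * inner ℝ Dv (J s)))
      + 2 * (h * inner ℝ Dv (v' + v)) := by
    linear_combination 2 * e0 - e2 + 2 * dW * e1
  -- sizes of the factors
  have p1 := sq_nonneg ‖v‖
  have p2 := sq_nonneg ‖v'‖
  have p3 := sq_nonneg ‖u‖
  have p4 := sq_nonneg ‖u'‖
  have p5 := sq_nonneg ‖um‖
  have nU : ‖u' + um‖ ^ 2 ≤ 2 * (B + B') := by
    have := norm_add_sq_le_two u' um
    linarith
  have nV : ‖v' + v‖ ^ 2 ≤ B + B' := by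
    have := norm_add_sq_le_two v' v
    linarith
  have AB : A * (1 + ‖u‖ ^ 2) ≤ A * B := by
    refine mul_le_mul_of_nonneg_left ?_ A0
    linarith
  have AM : A * (1 + ‖um‖ ^ 2) ≤ A * B := by
    refine mul_le_mul_of_nonneg_left ?_ A0
    linarith
  have AB' : A * (1 + ‖u'‖ ^ 2) ≤ A * B' := by
    refine mul_le_mul_of_nonneg_left ?_ A0
    linarith
  have AV : A * ‖v‖ ^ 2 ≤ A * B := by
    refine mul_le_mul_of_nonneg_left ?_ A0
    linarith
  have ns : ‖s‖ ^ 2 ≤ A * B := hs.trans AB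
  have nJs : ‖J s‖ ^ 2 ≤ A * B := (pow_le_pow_left₀ (norm_nonneg _) (hJ _) 2).trans ns
  have nD : ‖Dv‖ ^ 2 ≤ A * B := hDv.trans AV
  have AS : B + B' ≤ A * (B + B') := le_mul_of_one_le_left (by linarith) hA
  have nG : ‖G‖ ^ 2 ≤ 8 * (A * (B + B')) := by
    have h1 := norm_add_sq_le_two (f + fm) (J (u' + um))
    have h2 := norm_add_sq_le_two f fm
    have h3 : ‖J (u' + um)‖ ^ 2 ≤ ‖u' + um‖ ^ 2 := pow_le_pow_left₀ (norm_nonneg _) (hJ _) 2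
    linarith
  -- weight `τ` wherever the noise is `h` or `hm`, whose squares are of order `τ ^ 3` in expectation
  have b1 : -(h * inner ℝ (u' + um) s) ≤ τ * (B + B') + A * B * (h ^ 2 / τ) := by
    have b := neg_two_mul_inner_le τ hτ h (u' + um) s
    have c1 := mul_le_mul_of_nonneg_left nU hτ.le
    have c2 := mul_le_mul_of_nonneg_left ns hq
    have c3 := mul_nonneg (mul_nonneg A0 B0) hq
    linarith
  have b2 : -(hm * inner ℝ (u' + um) sm) ≤ τ * (B + B') + A * (1 + ‖um‖ ^ 2) * (hm ^ 2 / τ) := by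
    have b := neg_two_mul_inner_le τ hτ hm (u' + um) sm
    have hqm : 0 ≤ hm ^ 2 / τ := by positivity
    have c1 := mul_le_mul_of_nonneg_left nU hτ.le
    have c2 := mul_le_mul_of_nonneg_left hsm hqm
    have c3 : 0 ≤ A * (1 + ‖um‖ ^ 2) * (hm ^ 2 / τ) := by positivity
    linarith
  have b3 : τ * inner ℝ G (v' + v) ≤ 5 * (τ * (A * (B + B'))) := by
    have b := two_mul_inner_le 1 one_pos 1 G (v' + v)
    norm_num at b
    have : inner ℝ G (v' + v) ≤ 5 * (A * (B + B')) := by linarith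
    have := mul_le_mul_of_nonneg_left this hτ.le
    linarith
  have hAB : 0 ≤ A * B * dW ^ 2 := by positivity
  have b4 : τ * (-(dW * inner ℝ (u' + um) s)) ≤ τ * (B + B') + A * B * dW ^ 2 / 2 := by
    have b := neg_two_mul_inner_le 1 one_pos dW (u' + um) s
    have c := mul_le_mul_of_nonneg_left ns (sq_nonneg dW)
    norm_num at b
    have : -(dW * inner ℝ (u' + um) s) ≤ (B + B') + A * B * dW ^ 2 / 2 := by linarith
    have := mul_le_mul_of_nonneg_left this hτ.le
    have c' := mul_le_mul_of_nonneg_right hτ1 hAB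
    linarith
  have b5 : τ * (dW * inner ℝ G (J s)) ≤ 4 * (τ * (A * (B + B'))) + A * B * dW ^ 2 / 2 := by
    have b := two_mul_inner_le 1 one_pos dW G (J s)
    have c := mul_le_mul_of_nonneg_left nJs (sq_nonneg dW)
    norm_num at b
    have : dW * inner ℝ G (J s) ≤ 4 * (A * (B + B')) + A * B * dW ^ 2 / 2 := by linarith
    have := mul_le_mul_of_nonneg_left this hτ.le
    have c' := mul_le_mul_of_nonneg_right hτ1 hAB
    linarith
  have b6 : dW ^ 2 * ‖J s‖ ^ 2 ≤ A * B * dW ^ 2 := by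
    have c := mul_le_mul_of_nonneg_left nJs (sq_nonneg dW)
    linarith
  have b7 : 2 * (h * (dW * inner ℝ Dv (J s))) ≤ A * B * dW ^ 2 + A * B * (h ^ 2 / τ) := by
    have b := two_mul_inner_le 1 one_pos h (dW • Dv) (J s)
    rw [real_inner_smul_left, norm_smul, mul_pow, Real.norm_eq_abs, sq_abs] at b
    norm_num at b
    have c1 := mul_le_mul_of_nonneg_left nD (sq_nonneg dW)
    have c2 := mul_le_mul hq2 nJs (sq_nonneg _) hq
    linarith
  have b8 : 2 * (h * inner ℝ Dv (v' + v)) ≤ τ * (B + B') + A * B * (h ^ 2 / τ) := by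
    have b := two_mul_inner_le τ hτ h (v' + v) Dv
    rw [real_inner_comm] at b
    have c1 := mul_le_mul_of_nonneg_left nV hτ.le
    have c2 := mul_le_mul_of_nonneg_left nD hq
    linarith
  have c := mul_le_mul_of_nonneg_left AS hτ.le
  have c0 : 0 ≤ τ * (A * (B + B')) := by positivity
  have goal_eq : 15 * A * τ * (2 + (2 * ‖v‖ ^ 2 + ‖u‖ ^ 2 + ‖um‖ ^ 2)
      + (2 * ‖v'‖ ^ 2 + ‖u'‖ ^ 2 + ‖u‖ ^ 2)) = 15 * (τ * (A * (B + B'))) := by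
    rw [hB, hB']; ring
  rw [goal_eq]
  linarith

end Energy

/-! ### Moments of the noise increments -/

section Noise

variable {Ω : Type*} {mΩ : MeasurableSpace Ω} {P : Measure Ω}

/-- `Z` behaves, against integrable weights measurable with respect to `m`, like a random variable
that is independent of `m`, has mean zero and variance at most `s`. -/
structure IsNoise (P : Measure Ω) (m : MeasurableSpace Ω) (Z : Ω → ℝ) (s : ℝ) : Prop where
  integrable_mul : ∀ X : Ω → ℝ, StronglyMeasurable[m] X → Integrable X P →
    Integrable (fun ω => Z ω * X ω) P
  integral_mul : ∀ X : Ω → ℝ, StronglyMeasurable[m] X → Integrable X P →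
    ∫ ω, Z ω * X ω ∂P = 0
  integrable_sq_mul : ∀ X : Ω → ℝ, StronglyMeasurable[m] X → Integrable X P →
    Integrable (fun ω => Z ω ^ 2 * X ω) P
  integral_sq_mul_le : ∀ X : Ω → ℝ, StronglyMeasurable[m] X → Integrable X P → 0 ≤ X →
    ∫ ω, Z ω ^ 2 * X ω ∂P ≤ s * ∫ ω, X ω ∂P

lemma IsNoise.mono {m : MeasurableSpace Ω} {Z : Ω → ℝ} {s s' : ℝ} (h : IsNoise P m Z s)
    (hs : s ≤ s') : IsNoise P m Z s' where
  integrable_mul := h.integrable_mul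
  integral_mul := h.integral_mul
  integrable_sq_mul := h.integrable_sq_mul
  integral_sq_mul_le X h1 h2 h3 := (h.integral_sq_mul_le X h1 h2 h3).trans
    (mul_le_mul_of_nonneg_right hs (integral_nonneg h3))

lemma IsNoise.anti {m m' : MeasurableSpace Ω} {Z : Ω → ℝ} {s : ℝ} (h : IsNoise P m Z s)
    (hm : m' ≤ m) : IsNoise P m' Z s where
  integrable_mul X hX := h.integrable_mul X (hX.mono hm)
  integral_mul X hX := h.integral_mul X (hX.mono hm)
  integrable_sq_mul X hX := h.integrable_sq_mul X (hX.mono hm)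
  integral_sq_mul_le X hX := h.integral_sq_mul_le X (hX.mono hm)

/-- The increment of a Wiener process is noise for the past. -/
lemma IsWiener.isNoise_sub [IsProbabilityMeasure P] {T : ℝ≥0} {𝓕 : Filtration ℝ≥0 mΩ}
    {W : ℝ≥0 → Ω → ℝ} (hW : IsWiener T 𝓕 W P) {s t : ℝ≥0} (hst : s ≤ t) (htT : t ≤ T) :
    IsNoise P (𝓕 s) (fun ω => W t ω - W s ω) (t - s : ℝ) := by
  obtain ⟨c, hc, hlaw⟩ : ∃ c : ℝ≥0, (c : ℝ) = t - s ∧ HasLaw (W t - W s) (gaussianReal 0 c) P := by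
    refine ⟨_, ?_, hW.brownian.toIsPreBrownianReal.hasLaw_sub t s⟩
    rw [coe_nndist, Real.dist_eq]
    exact abs_of_nonneg (sub_nonneg.2 (by exact_mod_cast hst))
  set Z : Ω → ℝ := W t - W s with hZ
  have hZ' : (fun ω => W t ω - W s ω) = Z := rfl
  have hZm : AEStronglyMeasurable Z P := hlaw.aemeasurable.aestronglyMeasurable
  have hmem : MemLp Z 2 P := by
    have := memLp_id_gaussianReal (μ := 0) (v := c) 2
    rw [← hlaw.map_eq] at this
    simpa using this.comp_of_map hlaw.aemeasurable
  have hmean : ∫ ω, Z ω ∂P = 0 := by rw [hlaw.integral_eq, integral_id_gaussianReal]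
  have hsq : ∫ ω, Z ω ^ 2 ∂P = t - s := by
    have := hlaw.variance_eq
    rw [variance_id_gaussianReal, variance_eq_sub hmem, hmean] at this
    simp only [Pi.pow_apply] at this
    rw [← hc, ← this]; ring
  have hind : ∀ X : Ω → ℝ, StronglyMeasurable[𝓕 s] X → IndepFun Z X P := fun X hX => by
    rw [IndepFun_iff_Indep]
    refine (indep_of_indep_of_le_left (hW.indep s t hst htT) ?_).symm
    exact hX.measurable.comap_le
  have hind2 : ∀ X : Ω → ℝ, StronglyMeasurable[𝓕 s] X → IndepFun (fun ω => Z ω ^ 2) X P :=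
    fun X hX => (hind X hX).comp (φ := fun x => x ^ 2) (ψ := id) (by fun_prop) measurable_id
  rw [hZ']
  have hint2 : ∀ X : Ω → ℝ, StronglyMeasurable[𝓕 s] X → Integrable X P →
      ∫ ω, Z ω ^ 2 * X ω ∂P = (t - s) * ∫ ω, X ω ∂P := fun X hX hXi => by
    have := (hind2 X hX).integral_mul_eq_mul_integral (hZm.pow 2) hXi.1
    rw [hsq] at this
    exact this
  exact
    { integrable_mul := fun X hX hXi => (hind X hX).integrable_mul (hmem.integrable (by simp)) hXi
      integral_mul := fun X hX hXi => by
        have := (hind X hX).integral_mul_eq_mul_integral hZm hXi.1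
        rw [hmean, zero_mul] at this
        exact this
      integrable_sq_mul := fun X hX hXi => (hind2 X hX).integrable_mul hmem.integrable_sq hXi
      integral_sq_mul_le := fun X hX hXi _ => (hint2 X hX hXi).le }

/-- A weighted mean of noises, multiplied by `c`; the second moment is estimated by the
Cauchy–Schwarz inequality, without any relation between the summands. -/
lemma IsNoise.sum {m : MeasurableSpace Ω} {ι : Type*} (S : Finset ι) {Z : ι → Ω → ℝ} {s : ℝ}
    (hs : ∀ i ∈ S, IsNoise P m (Z i) s) (hZ : ∀ i ∈ S, AEStronglyMeasurable[mΩ] (Z i) P) (a : ℝ) :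
    IsNoise P m (fun ω => a * ∑ i ∈ S, Z i ω) (a ^ 2 * S.card ^ 2 * s) := by
  have hsq : ∀ (X : Ω → ℝ), 0 ≤ X → ∀ ω, (a * ∑ i ∈ S, Z i ω) ^ 2 * X ω
      ≤ a ^ 2 * S.card * ∑ i ∈ S, Z i ω ^ 2 * X ω := fun X hX ω => by
    rw [← Finset.sum_mul, mul_pow, ← mul_assoc]
    refine mul_le_mul_of_nonneg_right ?_ (hX ω)
    rw [mul_assoc]
    exact mul_le_mul_of_nonneg_left (sq_sum_le_card_mul_sum_sq) (sq_nonneg a)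
  have hmeas : AEStronglyMeasurable[mΩ] (fun ω => a * ∑ i ∈ S, Z i ω) P := by
    refine AEStronglyMeasurable.const_mul ?_ a
    exact S.aestronglyMeasurable_fun_sum hZ
  have hexp : ∀ (X : Ω → ℝ) ω, (a * ∑ i ∈ S, Z i ω) * X ω = a * ∑ i ∈ S, Z i ω * X ω :=
    fun X ω => by rw [mul_assoc, Finset.sum_mul]
  have hint : ∀ X : Ω → ℝ, StronglyMeasurable[m] X → Integrable X P →
      Integrable (fun ω => a ^ 2 * S.card * ∑ i ∈ S, Z i ω ^ 2 * X ω) P := fun X hX hXi =>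
    (integrable_finsetSum S fun i hi => (hs i hi).integrable_sq_mul X hX hXi).const_mul _
  have hint' : ∀ X : Ω → ℝ, StronglyMeasurable[m] X → Integrable X P →
      Integrable (fun ω => (a * ∑ i ∈ S, Z i ω) ^ 2 * X ω) P := fun X hX hXi => by
    refine (hint |X| hX.norm hXi.abs).mono' ((hmeas.pow 2).mul hXi.1) (ae_of_all _ fun ω => ?_)
    rw [Real.norm_eq_abs, abs_mul, abs_of_nonneg (sq_nonneg _)]
    exact hsq |X| (abs_nonneg X) ω
  refine ⟨fun X hX hXi => ?_, fun X hX hXi => ?_, hint', fun X hX hXi hX0 => ?_⟩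
  · simp only [hexp]
    exact (integrable_finsetSum S fun i hi => (hs i hi).integrable_mul X hX hXi).const_mul a
  · simp only [hexp]
    rw [integral_const_mul, integral_finsetSum S fun i hi => (hs i hi).integrable_mul X hX hXi,
      Finset.sum_eq_zero fun i hi => (hs i hi).integral_mul X hX hXi, mul_zero]
  · calc ∫ ω, (a * ∑ i ∈ S, Z i ω) ^ 2 * X ω ∂P
        ≤ ∫ ω, a ^ 2 * S.card * ∑ i ∈ S, Z i ω ^ 2 * X ω ∂P :=
          integral_mono (hint' X hX hXi) (hint X hX hXi) (hsq X hX0)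
      _ = a ^ 2 * S.card * ∑ i ∈ S, ∫ ω, Z i ω ^ 2 * X ω ∂P := by
          rw [integral_const_mul,
            integral_finsetSum S fun i hi => (hs i hi).integrable_sq_mul X hX hXi]
      _ ≤ a ^ 2 * S.card * ∑ i ∈ S, s * ∫ ω, X ω ∂P := by
          gcongr with i hi
          exact (hs i hi).integral_sq_mul_le X hX hXi hX0
      _ = a ^ 2 * S.card ^ 2 * s * ∫ ω, X ω ∂P := by
          rw [Finset.sum_const, nsmul_eq_mul]; ring

variable {T : ℝ≥0} {𝓕 : Filtration ℝ≥0 mΩ} {W : ℝ≥0 → Ω → ℝ}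

lemma node_succ (T : ℝ≥0) (N n : ℕ) : node T N (n + 1) = node T N n + tau T N := by
  simp [node]; ring

lemma node_mono (T : ℝ≥0) (N : ℕ) : Monotone (node T N) := fun a b h => by
  unfold node; gcongr

lemma node_le {N n : ℕ} (hn : n ≤ N) (T : ℝ≥0) : node T N n ≤ T := by
  refine (node_mono T N hn).trans ?_
  rcases Nat.eq_zero_or_pos N with rfl | hN
  · simp [node]
  · rw [node, tau, mul_div_cancel₀]
    exact_mod_cast hN.ne'

lemma mul_tau (T : ℝ≥0) {N : ℕ} (hN : 0 < N) : (N : ℝ) * tau T N = T := by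
  have hN' : (N : ℝ≥0) ≠ 0 := by exact_mod_cast hN.ne'
  have h : (N : ℝ≥0) * tau T N = T := mul_div_cancel₀ _ hN'
  exact_mod_cast congrArg NNReal.toReal h

lemma tau_pos (hT : 0 < T) {N : ℕ} (hN : 0 < N) : 0 < (tau T N : ℝ) := by
  exact_mod_cast (div_pos hT (by exact_mod_cast hN) : 0 < T / (N : ℝ≥0))

lemma isNoise_incr [IsProbabilityMeasure P] (hW : IsWiener T 𝓕 W P) {N n : ℕ} (hn : n < N) :
    IsNoise P (𝓕 (node T N n)) (incr W T N n) (tau T N) := by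
  have h := hW.isNoise_sub (node_mono T N n.le_succ) (node_le (Nat.succ_le_of_lt hn) T)
  refine h.mono (le_of_eq ?_)
  rw [node_succ]; push_cast; ring

/-- `hatIncr` is the mean of the increments of `W` from the inner nodes to `t_{n+1}`, times `τ`. -/
lemma hatIncr_eq (W : ℝ≥0 → Ω → ℝ) {T : ℝ≥0} (hT : 0 < T) {N : ℕ} (hN : 0 < N) (n : ℕ) :
    0 < subdiv T N ∧ hatIncr W T N n = fun ω => ((tau T N / subdiv T N : ℝ≥0) : ℝ) *
      ∑ l ∈ Finset.Icc 1 (subdiv T N), (W (node T N (n + 1)) ω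
        - W (node T N n + l * (tau T N / subdiv T N)) ω) := by
  have hτ : 0 < tau T N := div_pos hT (by exact_mod_cast hN)
  have hM : 0 < subdiv T N := Nat.ceil_pos.2 (by positivity)
  refine ⟨hM, funext fun ω => ?_⟩
  have hM' : ((subdiv T N : ℝ≥0) : ℝ) ≠ 0 := by exact_mod_cast hM.ne'
  rw [hatIncr, Finset.sum_sub_distrib, mul_sub, Finset.sum_const, Nat.card_Icc, nsmul_eq_mul]
  congr 1
  push_cast at hM' ⊢
  rw [← mul_assoc, div_mul_cancel₀ _ hM']

lemma isNoise_hatIncr [IsProbabilityMeasure P] (hW : IsWiener T 𝓕 W P) (hT : 0 < T) {N n : ℕ}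
    (hn : n < N) : IsNoise P (𝓕 (node T N n)) (hatIncr W T N n) ((tau T N : ℝ) ^ 3) := by
  obtain ⟨hM, heq⟩ := hatIncr_eq W hT (Nat.zero_lt_of_lt hn) n
  have hM' : ((subdiv T N : ℝ≥0) : ℝ) ≠ 0 := by exact_mod_cast hM.ne'
  have hMn : (subdiv T N : ℝ≥0) ≠ 0 := by exact_mod_cast hM.ne'
  rw [heq]
  have hle : ∀ l ∈ Finset.Icc 1 (subdiv T N),
      node T N n + l * (tau T N / subdiv T N) ≤ node T N (n + 1) := fun l hl => by
    rw [node_succ]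
    gcongr
    calc (l : ℝ≥0) * (tau T N / subdiv T N) ≤ subdiv T N * (tau T N / subdiv T N) := by
          gcongr; exact (Finset.mem_Icc.1 hl).2
      _ = tau T N := mul_div_cancel₀ _ hMn
  have hT' := node_le (Nat.succ_le_of_lt hn) T
  have h := IsNoise.sum (m := 𝓕 (node T N n)) (P := P) (s := tau T N)
    (Finset.Icc 1 (subdiv T N)) (Z := fun l ω => W (node T N (n + 1)) ω
        - W (node T N n + l * (tau T N / subdiv T N)) ω) (fun l hl => ?_) (fun l hl => ?_)
    ((tau T N / subdiv T N : ℝ≥0) : ℝ)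
  · refine h.mono (le_of_eq ?_)
    rw [Nat.card_Icc, Nat.add_sub_cancel]
    push_cast at hM' ⊢
    field_simp
  · refine ((hW.isNoise_sub (hle l hl) hT').anti (𝓕.mono le_self_add)).mono ?_
    rw [node_succ]
    push_cast
    have : (0 : ℝ) ≤ l * (tau T N / subdiv T N) := by positivity
    linarith
  · exact ((hW.adapted _ hT').mono (𝓕.le _)).aestronglyMeasurable.sub
      ((hW.adapted _ ((hle l hl).trans hT')).mono (𝓕.le _)).aestronglyMeasurable

end Noise

/-! ### Consequences of the structure assumptions -/

section Growth

variable {d : ℕ} {D : Set (Rn d)} {F : H01 D → L2 D} {σ : H01 D → H01 D} {K : ℝ}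

/-- The constant `A` in the quadratic growth bounds `‖F u‖², ‖σ u‖² ≤ A (1 + ‖u‖²)`. -/
def growthConst (K : ℝ) : ℝ := 2 * K ^ 2 + 1

lemma one_le_growthConst (K : ℝ) : 1 ≤ growthConst K := by
  have := sq_nonneg K
  unfold growthConst; linarith

lemma sq_le_growthConst {a b : ℝ} (ha : 0 ≤ a) (h : a ≤ K * (1 + b)) :
    a ^ 2 ≤ growthConst K * (1 + b ^ 2) := by
  have h1 : a ^ 2 ≤ K ^ 2 * (1 + b) ^ 2 := by rw [← mul_pow]; exact pow_le_pow_left₀ ha h 2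
  have h2 : K ^ 2 * (1 + b) ^ 2 ≤ K ^ 2 * (2 * (1 + b ^ 2)) :=
    mul_le_mul_of_nonneg_left (by nlinarith [sq_nonneg (1 - b)]) (sq_nonneg K)
  unfold growthConst
  nlinarith [sq_nonneg b]

lemma LinearGrowth.norm_sigma_sq_le (hg : LinearGrowth F σ K) (u : H01 D) :
    ‖σ u‖ ^ 2 ≤ growthConst K * (1 + ‖u‖ ^ 2) := by
  obtain ⟨p, -, -, hp⟩ := hg.inH1 u
  exact sq_le_growthConst (norm_nonneg _) (by linarith [norm_nonneg p])

lemma LinearGrowth.exists_graph (hg : LinearGrowth F σ K) (u : H01 D) :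
    ∃ p ∈ H1 D, p.fst = F u ∧ ‖p‖ ^ 2 ≤ growthConst K * (1 + ‖u‖ ^ 2) := by
  obtain ⟨p, hp1, hp2, hp⟩ := hg.inH1 u
  exact ⟨p, hp1, hp2, sq_le_growthConst (norm_nonneg _) (by linarith [norm_nonneg (σ u)])⟩

lemma norm_fst_sq_le (p : GraphSpace D) : ‖p.fst‖ ^ 2 ≤ ‖p‖ ^ 2 := by
  rw [WithLp.prod_norm_sq_eq_of_L2]
  exact le_add_of_nonneg_right (sq_nonneg _)

lemma LinearGrowth.norm_F_sq_le (hg : LinearGrowth F σ K) (u : H01 D) :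
    ‖F u‖ ^ 2 ≤ growthConst K * (1 + ‖u‖ ^ 2) := by
  obtain ⟨p, -, hp2, hp⟩ := hg.exists_graph u
  rw [← hp2]
  exact (norm_fst_sq_le p).trans hp

lemma LinearGrowth.nonneg (hg : LinearGrowth F σ K) : 0 ≤ K := by
  have h := hg.inL2 0
  have h1 : 0 ≤ K * (1 + ‖toL2 (0 : H01 D)‖) := le_trans (by positivity) h
  exact nonneg_of_mul_nonneg_left h1 (by positivity)

lemma LipschitzBound.continuous_sigma (hl : LipschitzBound F σ K) : Continuous σ := by
  refine (LipschitzWith.of_dist_le_mul (K := K.toNNReal) fun u w => ?_).continuous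
  obtain ⟨p, -, -, hp⟩ := hl.inH1 u w
  rw [dist_eq_norm, dist_eq_norm]
  calc ‖σ u - σ w‖ ≤ K * ‖u - w‖ := by linarith [norm_nonneg p]
    _ ≤ K.toNNReal * ‖u - w‖ := by gcongr; exact Real.le_coe_toNNReal K

lemma norm_toL2_lineDeriv_sq_le (hg : LinearGrowth F σ K) (hl : LipschitzBound F σ K)
    (u w : H01 D) : ‖toL2 (lineDeriv ℝ σ u w)‖ ^ 2 ≤ growthConst K * ‖toL2 w‖ ^ 2 := by
  have h := norm_toL2_lineDeriv_le (σ := σ) hg.nonneg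
    (fun u w => by linarith [hl.inL2 u w, norm_nonneg (F u - F w)]) u w
  have h2 := pow_le_pow_left₀ (norm_nonneg _) h 2
  rw [mul_pow] at h2
  refine h2.trans (mul_le_mul_of_nonneg_right ?_ (sq_nonneg _))
  unfold growthConst
  nlinarith [sq_nonneg K]

end Growth

/-! ### Discrete Gronwall inequality and expectations of one-step inequalities -/

/-- Discrete Gronwall inequality for an implicit recursion. -/
lemma discrete_gronwall {a : ℕ → ℝ} {c τ : ℝ} {N : ℕ} (ha : ∀ n, 0 ≤ a n) (hc : 0 ≤ c)
    (hτ : 0 ≤ τ) (hcτ : c * τ ≤ 1 / 2)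
    (h : ∀ n < N, a (n + 1) ≤ a n + c * τ * (1 + a n + a (n + 1))) {n : ℕ} (hnN : n ≤ N) :
    a n + 1 ≤ Real.exp (4 * c * (N * τ)) * (a 0 + 1) := by
  have hx : 0 ≤ c * τ := mul_nonneg hc hτ
  have key : ∀ n ≤ N, a n + 1 ≤ (1 + 4 * (c * τ)) ^ n * (a 0 + 1) := by
    intro n
    induction n with
    | zero => intro _; simp
    | succ n ih =>
      intro hN
      have h1 := h n (by omega)
      have h2 : a (n + 1) + 1 ≤ (1 + 4 * (c * τ)) * (a n + 1) := by
        -- `(1 + x) / (1 - x) ≤ 1 + 4 x` for `0 ≤ x ≤ 1 / 2`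
        have h3 : (1 - c * τ) * (a (n + 1) + 1) ≤ (1 + c * τ) * (a n + 1) := by nlinarith [ha n]
        have h4 : (1 + c * τ) * (a n + 1) ≤ (1 - c * τ) * ((1 + 4 * (c * τ)) * (a n + 1)) := by
          rw [← mul_assoc]
          refine mul_le_mul_of_nonneg_right ?_ (by linarith [ha n])
          nlinarith
        exact le_of_mul_le_mul_left (h3.trans h4) (by linarith)
      calc a (n + 1) + 1 ≤ (1 + 4 * (c * τ)) * (a n + 1) := h2
        _ ≤ (1 + 4 * (c * τ)) * ((1 + 4 * (c * τ)) ^ n * (a 0 + 1)) :=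
            mul_le_mul_of_nonneg_left (ih (by omega)) (by linarith)
        _ = _ := by ring
  refine (key n hnN).trans (mul_le_mul_of_nonneg_right ?_ (by linarith [ha 0]))
  calc (1 + 4 * (c * τ)) ^ n ≤ (1 + 4 * (c * τ)) ^ N := pow_le_pow_right₀ (by linarith) hnN
    _ ≤ Real.exp (4 * (c * τ)) ^ N :=
        pow_le_pow_left₀ (by linarith) (by linarith [Real.add_one_le_exp (4 * (c * τ))]) N
    _ = Real.exp (4 * c * (N * τ)) := by rw [← Real.exp_nat_mul]; congr 1; ring

section Expectation

variable {Ω : Type*} {mΩ : MeasurableSpace Ω} {P : Measure Ω}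

/-- An implicit pathwise inequality yields integrability of the new value as well as the
corresponding inequality between expectations. -/
lemma expectation_step [IsProbabilityMeasure P] {e e' R : Ω → ℝ} {κ : ℝ}
    (hκ : κ ≤ 1 / 2) (he : Integrable e P) (hR : Integrable R P)
    (he'm : AEStronglyMeasurable e' P) (he' : 0 ≤ e')
    (h : ∀ᵐ ω ∂P, e' ω ≤ e ω + R ω + κ * (1 + e' ω)) :
    Integrable e' P ∧ ∫ ω, e' ω ∂P ≤ ∫ ω, e ω ∂P + ∫ ω, R ω ∂P + κ * (1 + ∫ ω, e' ω ∂P) := by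
  have hi : Integrable e' P := by
    refine Integrable.mono' (((he.add hR).add (integrable_const κ)).const_mul 2) he'm ?_
    filter_upwards [h] with ω hω
    rw [Real.norm_eq_abs, abs_of_nonneg (he' ω)]
    simp only [Pi.add_apply]
    nlinarith [he' ω, mul_nonneg (sub_nonneg.2 hκ) (he' ω)]
  refine ⟨hi, ?_⟩
  have hκi : Integrable (fun ω => κ * (1 + e' ω)) P := ((integrable_const 1).add hi).const_mul κ
  have h2 : _ ≤ ∫ ω, (e + R + fun ω => κ * (1 + e' ω)) ω ∂P :=
    integral_mono_ae hi ((he.add hR).add hκi) h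
  rw [integral_add' (he.add hR) hκi, integral_add' he hR, integral_const_mul,
    integral_add (integrable_const 1) hi] at h2
  simpa using h2

end Expectation

/-! ### Expectation of the energy inequalities -/

section ExpectedEnergy

variable {Ω : Type*} {mΩ : MeasurableSpace Ω} {P : Measure Ω}

/-- The inner products against which the noise is integrated are admissible weights. -/
lemma integrable_inner_of_sq {Y : Type*} [NormedAddCommGroup Y] [InnerProductSpace ℝ Y]
    {m : MeasurableSpace Ω} (hm : m ≤ mΩ) {x y : Ω → Y} (hx : StronglyMeasurable[m] x)
    (hy : StronglyMeasurable[m] y) {E : Ω → ℝ} (hE : Integrable E P)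
    (hxE : ∀ ω, ‖x ω‖ ^ 2 ≤ E ω) (hyE : ∀ ω, ‖y ω‖ ^ 2 ≤ E ω) :
    StronglyMeasurable[m] (fun ω => inner ℝ (x ω) (y ω)) ∧
      Integrable (fun ω => inner ℝ (x ω) (y ω)) P := by
  have hs : StronglyMeasurable[m] (fun ω => inner ℝ (x ω) (y ω)) :=
    continuous_inner.comp_stronglyMeasurable (hx.prodMk hy)
  refine ⟨hs, hE.mono' (hs.mono hm).aestronglyMeasurable (ae_of_all _ fun ω => ?_)⟩
  have := norm_inner_le_norm (𝕜 := ℝ) (x ω) (y ω)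
  nlinarith [sq_nonneg (‖x ω‖ - ‖y ω‖), hxE ω, hyE ω]

/-- Expectation of the energy inequality for one step of the implicit scheme: the noise terms that
are linear in the noise vanish, the quadratic ones are of order `τ`. -/
lemma expected_energy_le_zero {X Y : Type*} [NormedAddCommGroup X] [InnerProductSpace ℝ X]
    [NormedAddCommGroup Y] [InnerProductSpace ℝ Y] [IsProbabilityMeasure P] {A τ : ℝ}
    (hτ : 0 < τ) (hτ1 : τ ≤ 1) (hA : 1 ≤ A) (hAτ : 10 * A * τ ≤ 1)
    {m : MeasurableSpace Ω} (hm : m ≤ mΩ) {dW h : Ω → ℝ} (hnd : IsNoise P m dW τ)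
    (hnh : IsNoise P m h (τ ^ 3)) {u u' s : Ω → X} {v v' r : Ω → Y}
    (hu : StronglyMeasurable[m] u) (hv : StronglyMeasurable[m] v) (hs : StronglyMeasurable[m] s)
    (hr : StronglyMeasurable[m] r) (hu' : AEStronglyMeasurable[mΩ] u' P)
    (hv' : AEStronglyMeasurable[mΩ] v' P)
    (hsu : ∀ ω, ‖s ω‖ ^ 2 ≤ A * (1 + ‖u ω‖ ^ 2)) (hru : ∀ ω, ‖r ω‖ ≤ ‖s ω‖)
    (hi : Integrable (fun ω => ‖v ω‖ ^ 2 + ‖u ω‖ ^ 2) P)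
    (hle : ∀ᵐ ω ∂P, ‖v' ω‖ ^ 2 + ‖u' ω‖ ^ 2 ≤ ‖v ω‖ ^ 2 + ‖u ω‖ ^ 2
      - 2 * (h ω * inner ℝ (u ω) (s ω)) + 2 * (dW ω * inner ℝ (r ω) (v ω))
      + A * (h ω ^ 2 + dW ω ^ 2) * (1 + ‖u ω‖ ^ 2)
      + 5 * A * τ * (1 + ‖v' ω‖ ^ 2 + ‖u' ω‖ ^ 2)) :
    Integrable (fun ω => ‖v' ω‖ ^ 2 + ‖u' ω‖ ^ 2) P ∧
      ∫ ω, ‖v' ω‖ ^ 2 + ‖u' ω‖ ^ 2 ∂P ≤ ∫ ω, ‖v ω‖ ^ 2 + ‖u ω‖ ^ 2 ∂P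
        + 7 * A * τ * (1 + ∫ ω, ‖v ω‖ ^ 2 + ‖u ω‖ ^ 2 ∂P
          + ∫ ω, ‖v' ω‖ ^ 2 + ‖u' ω‖ ^ 2 ∂P) := by
  -- the weights of the noise terms
  have hum : StronglyMeasurable[m] fun ω => ‖u ω‖ ^ 2 := hu.norm.pow 2
  have hui : Integrable (fun ω => ‖u ω‖ ^ 2) P := hi.mono' (hum.mono hm).aestronglyMeasurable
    (ae_of_all _ fun ω => by
      rw [Real.norm_eq_abs, abs_of_nonneg (sq_nonneg _)]; linarith [sq_nonneg ‖v ω‖])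
  set Z : Ω → ℝ := fun ω => 1 + ‖u ω‖ ^ 2 with hY
  have hYm : StronglyMeasurable[m] Z := stronglyMeasurable_const.add hum
  have hYi : Integrable Z P := (integrable_const 1).add hui
  have hY0 : 0 ≤ Z := fun ω => by positivity
  set E : Ω → ℝ := fun ω => A * (1 + (‖v ω‖ ^ 2 + ‖u ω‖ ^ 2)) with hE
  have hEi : Integrable E P := ((integrable_const 1).add hi).const_mul A
  have hE1 : ∀ ω, ‖v ω‖ ^ 2 + ‖u ω‖ ^ 2 ≤ E ω := fun ω => by
    have : 0 ≤ ‖v ω‖ ^ 2 + ‖u ω‖ ^ 2 := by positivity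
    simp only [hE]; nlinarith
  have hEσ : ∀ ω, ‖s ω‖ ^ 2 ≤ E ω := fun ω =>
    (hsu ω).trans (mul_le_mul_of_nonneg_left (by nlinarith [sq_nonneg ‖v ω‖])
      (by linarith))
  have hEJ : ∀ ω, ‖r ω‖ ^ 2 ≤ E ω := fun ω =>
    (pow_le_pow_left₀ (norm_nonneg _) (hru ω) 2).trans (hEσ ω)
  obtain ⟨hX1m, hX1i⟩ := integrable_inner_of_sq hm hu hs hEi
    (fun ω => by linarith [hE1 ω, sq_nonneg ‖v ω‖]) hEσ
  obtain ⟨hX2m, hX2i⟩ := integrable_inner_of_sq hm hr hv hEi hEJ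
    (fun ω => by linarith [hE1 ω, sq_nonneg ‖u ω‖])
  have i1 := (hnh.integrable_mul _ hX1m hX1i).const_mul (-2)
  have i2 := (hnd.integrable_mul _ hX2m hX2i).const_mul 2
  have i3 := (hnh.integrable_sq_mul _ hYm hYi).const_mul A
  have i4 := (hnd.integrable_sq_mul _ hYm hYi).const_mul A
  have hstep := expectation_step (P := P) (e := fun ω => ‖v ω‖ ^ 2 + ‖u ω‖ ^ 2)
    (e' := fun ω => ‖v' ω‖ ^ 2 + ‖u' ω‖ ^ 2) (κ := 5 * A * τ)
    (by linarith) hi (((i1.add i2).add i3).add i4) ?_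
    (fun ω => by positivity) ?_
  · refine ⟨hstep.1, hstep.2.trans ?_⟩
    rw [integral_add' ((i1.add i2).add i3) i4, integral_add' (i1.add i2) i3, integral_add' i1 i2,
      integral_const_mul, integral_const_mul, integral_const_mul, integral_const_mul,
      hnh.integral_mul _ hX1m hX1i, hnd.integral_mul _ hX2m hX2i]
    have q1 := hnh.integral_sq_mul_le _ hYm hYi hY0
    have q2 := hnd.integral_sq_mul_le _ hYm hYi hY0
    have q3 : ∫ ω, Z ω ∂P ≤ 1 + ∫ ω, ‖v ω‖ ^ 2 + ‖u ω‖ ^ 2 ∂P := by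
      have := integral_mono (g := fun ω => 1 + (‖v ω‖ ^ 2 + ‖u ω‖ ^ 2)) hYi
        ((integrable_const 1).add hi) (fun ω => by
          simp only [hY]; linarith [sq_nonneg ‖v ω‖])
      rwa [integral_add (integrable_const 1) hi, integral_const, probReal_univ, one_smul] at this
    have q0 : 0 ≤ ∫ ω, Z ω ∂P := integral_nonneg hY0
    have q4 : τ ^ 3 * ∫ ω, Z ω ∂P ≤ τ * ∫ ω, Z ω ∂P := by
      refine mul_le_mul_of_nonneg_right ?_ q0
      nlinarith [mul_nonneg hτ.le (sub_nonneg.2 hτ1), mul_nonneg (sq_nonneg τ) (sub_nonneg.2 hτ1)]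
    set a := ∫ ω, ‖v ω‖ ^ 2 + ‖u ω‖ ^ 2 ∂P
    have ha' : 0 ≤ ∫ ω, ‖v' ω‖ ^ 2 + ‖u' ω‖ ^ 2 ∂P :=
      integral_nonneg fun ω => by positivity
    set a' := ∫ ω, ‖v' ω‖ ^ 2 + ‖u' ω‖ ^ 2 ∂P
    have hAτ0 : 0 ≤ A * τ := by positivity
    have q5 := mul_le_mul_of_nonneg_left (q1.trans q4) (by linarith : 0 ≤ A)
    have q6 := mul_le_mul_of_nonneg_left q2 (by linarith : 0 ≤ A)
    have q7 := mul_le_mul_of_nonneg_left q3 hAτ0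
    have q8 : 0 ≤ a := integral_nonneg fun ω => by positivity
    have q9 := mul_nonneg hAτ0 q8
    have q10 := mul_nonneg hAτ0 ha'
    linarith
  · exact (hv'.norm.pow 2).add (hu'.norm.pow 2)
  · filter_upwards [hle] with ω h1
    simp only [Pi.add_apply, hY]
    linarith

/-- Expectation of the energy inequality for one step of the scheme with `θ = 1/2`; `hm` is the
noise of the previous step, whose weight `‖um‖²` is measurable with respect to the past `m'` of that
step. -/
lemma expected_energy_le_half {X Y : Type*} [NormedAddCommGroup X] [InnerProductSpace ℝ X]
    [NormedAddCommGroup Y] [InnerProductSpace ℝ Y] [IsProbabilityMeasure P] {A τ : ℝ}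
    (hτ : 0 < τ) (hA : 1 ≤ A) (hAτ : 30 * A * τ ≤ 1)
    {m m' : MeasurableSpace Ω} (hmΩ : m ≤ mΩ) (hm'm : m' ≤ m) {dW h hm : Ω → ℝ}
    (hnd : IsNoise P m dW τ) (hnh : IsNoise P m h (τ ^ 3)) (hnm : IsNoise P m' hm (τ ^ 3))
    {um u u' : Ω → X} {v v' r : Ω → Y} (hum : StronglyMeasurable[m'] um)
    (hu : StronglyMeasurable[m] u) (hv : StronglyMeasurable[m] v) (hr : StronglyMeasurable[m] r)
    (hu' : AEStronglyMeasurable[mΩ] u' P) (hv' : AEStronglyMeasurable[mΩ] v' P)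
    (hru : ∀ ω, ‖r ω‖ ^ 2 ≤ A * (1 + ‖u ω‖ ^ 2))
    (hi : Integrable (fun ω => 2 * ‖v ω‖ ^ 2 + ‖u ω‖ ^ 2 + ‖um ω‖ ^ 2) P)
    (hle : ∀ᵐ ω ∂P, 2 * ‖v' ω‖ ^ 2 + ‖u' ω‖ ^ 2 + ‖u ω‖ ^ 2
      ≤ 2 * ‖v ω‖ ^ 2 + ‖u ω‖ ^ 2 + ‖um ω‖ ^ 2 + 4 * (dW ω * inner ℝ (r ω) (v ω))
      + A * (1 + (2 * ‖v ω‖ ^ 2 + ‖u ω‖ ^ 2 + ‖um ω‖ ^ 2)) * (3 * (h ω ^ 2 / τ) + 4 * dW ω ^ 2)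
      + A * (1 + ‖um ω‖ ^ 2) * (hm ω ^ 2 / τ)
      + 15 * A * τ * (2 + (2 * ‖v ω‖ ^ 2 + ‖u ω‖ ^ 2 + ‖um ω‖ ^ 2)
          + (2 * ‖v' ω‖ ^ 2 + ‖u' ω‖ ^ 2 + ‖u ω‖ ^ 2))) :
    Integrable (fun ω => 2 * ‖v' ω‖ ^ 2 + ‖u' ω‖ ^ 2 + ‖u ω‖ ^ 2) P ∧
      ∫ ω, 2 * ‖v' ω‖ ^ 2 + ‖u' ω‖ ^ 2 + ‖u ω‖ ^ 2 ∂P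
      ≤ ∫ ω, 2 * ‖v ω‖ ^ 2 + ‖u ω‖ ^ 2 + ‖um ω‖ ^ 2 ∂P
        + 38 * A * τ * (1 + ∫ ω, 2 * ‖v ω‖ ^ 2 + ‖u ω‖ ^ 2 + ‖um ω‖ ^ 2 ∂P
          + ∫ ω, 2 * ‖v' ω‖ ^ 2 + ‖u' ω‖ ^ 2 + ‖u ω‖ ^ 2 ∂P) := by
  -- the weights of the noise terms
  set e : Ω → ℝ := fun ω => 2 * ‖v ω‖ ^ 2 + ‖u ω‖ ^ 2 + ‖um ω‖ ^ 2 with he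
  have he0 : ∀ ω, 0 ≤ e ω := fun ω => by positivity
  have hem : StronglyMeasurable[m] e :=
    (((hv.norm.pow 2).const_mul 2).add (hu.norm.pow 2)).add
      ((hum.mono hm'm).norm.pow 2)
  set V : Ω → ℝ := fun ω => 1 + e ω with hV
  have hVm : StronglyMeasurable[m] V := stronglyMeasurable_const.add hem
  have hVi : Integrable V P := (integrable_const 1).add hi
  have hV0 : 0 ≤ V := fun ω => add_nonneg zero_le_one (he0 ω)
  set Z : Ω → ℝ := fun ω => 1 + ‖um ω‖ ^ 2 with hZ
  have hZm : StronglyMeasurable[m'] Z :=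
    stronglyMeasurable_const.add (hum.norm.pow 2)
  have hZY : ∀ ω, Z ω ≤ V ω := fun ω => by
    simp only [hZ, hV, he]; linarith [sq_nonneg ‖v ω‖, sq_nonneg ‖u ω‖]
  have hZ0 : 0 ≤ Z := fun ω => by positivity
  have hZi : Integrable Z P := hVi.mono' (hZm.mono (hm'm.trans hmΩ)).aestronglyMeasurable
    (ae_of_all _ fun ω => by
      rw [Real.norm_eq_abs, abs_of_nonneg (hZ0 ω)]; exact hZY ω)
  have hEi : Integrable (fun ω => A * V ω) P := hVi.const_mul A
  obtain ⟨hXm, hXi⟩ := integrable_inner_of_sq hmΩ hr hv hEi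
    (fun ω => (hru ω).trans (mul_le_mul_of_nonneg_left
      (by simp only [hV, he]; linarith [sq_nonneg ‖v ω‖, sq_nonneg ‖um ω‖]) (by linarith)))
    (fun ω => by
      have h1 : V ω ≤ A * V ω := le_mul_of_one_le_left (hV0 ω) hA
      have h2 : ‖v ω‖ ^ 2 ≤ V ω := by
        simp only [hV, he]
        linarith [sq_nonneg ‖v ω‖, sq_nonneg ‖um ω‖, sq_nonneg ‖u ω‖]
      exact h2.trans h1)
  have i1 := (hnd.integrable_mul _ hXm hXi).const_mul 4
  have i2 := (hnh.integrable_sq_mul _ hVm hVi).const_mul (3 * A / τ)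
  have i3 := (hnd.integrable_sq_mul _ hVm hVi).const_mul (4 * A)
  have i4 := (hnm.integrable_sq_mul _ hZm hZi).const_mul (A / τ)
  have i5 := hVi.const_mul (15 * A * τ)
  have hstep := expectation_step (P := P) (e := e)
    (e' := fun ω => 2 * ‖v' ω‖ ^ 2 + ‖u' ω‖ ^ 2 + ‖u ω‖ ^ 2)
    (κ := 15 * A * τ)
    (by linarith) hi ((((i1.add i2).add i3).add i4).add i5) ?_
    (fun ω => by positivity) ?_
  · refine ⟨hstep.1, hstep.2.trans ?_⟩
    rw [integral_add' (((i1.add i2).add i3).add i4) i5, integral_add' ((i1.add i2).add i3) i4,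
      integral_add' (i1.add i2) i3, integral_add' i1 i2,
      integral_const_mul, integral_const_mul, integral_const_mul, integral_const_mul,
      integral_const_mul, hnd.integral_mul _ hXm hXi]
    have q1 := hnh.integral_sq_mul_le _ hVm hVi hV0
    have q2 := hnd.integral_sq_mul_le _ hVm hVi hV0
    have q3 := hnm.integral_sq_mul_le _ hZm hZi hZ0
    have q4 : ∫ ω, V ω ∂P = 1 + ∫ ω, e ω ∂P := by
      rw [integral_add (integrable_const 1) hi, integral_const, probReal_univ, one_smul]
    have q5 : ∫ ω, Z ω ∂P ≤ ∫ ω, V ω ∂P := integral_mono hZi hVi hZY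
    have q0 : 0 ≤ ∫ ω, V ω ∂P := integral_nonneg hV0
    have ha' : 0 ≤ ∫ ω, 2 * ‖v' ω‖ ^ 2 + ‖u' ω‖ ^ 2 + ‖u ω‖ ^ 2 ∂P :=
      integral_nonneg fun ω => by positivity
    set a' := ∫ ω, 2 * ‖v' ω‖ ^ 2 + ‖u' ω‖ ^ 2 + ‖u ω‖ ^ 2 ∂P
    set y := ∫ ω, V ω ∂P
    have hAτ0 : 0 ≤ A * τ := by positivity
    have hτsq : A * τ ^ 2 * y ≤ A * τ * y := by
      refine mul_le_mul_of_nonneg_right ?_ q0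
      have hτ1 : τ ≤ 1 := by nlinarith
      nlinarith
    have r1 : 3 * A / τ * ∫ ω, h ω ^ 2 * V ω ∂P ≤ 3 * (A * τ * y) := by
      calc 3 * A / τ * ∫ ω, h ω ^ 2 * V ω ∂P ≤ 3 * A / τ * (τ ^ 3 * y) := by
            gcongr
        _ = 3 * (A * τ ^ 2 * y) := by field_simp
        _ ≤ _ := by linarith
    have r2 : A / τ * ∫ ω, hm ω ^ 2 * Z ω ∂P ≤ A * τ * y := by
      calc A / τ * ∫ ω, hm ω ^ 2 * Z ω ∂P ≤ A / τ * (τ ^ 3 * y) := by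
            gcongr
            exact q3.trans (mul_le_mul_of_nonneg_left q5 (by positivity))
        _ = A * τ ^ 2 * y := by field_simp
        _ ≤ _ := hτsq
    have r3 := mul_le_mul_of_nonneg_left q2 (by linarith : 0 ≤ 4 * A)
    have r4 : A * τ * y = A * τ * (1 + ∫ ω, e ω ∂P) := by rw [q4]
    change _ ≤ ∫ ω, e ω ∂P + 38 * A * τ * (1 + ∫ ω, e ω ∂P + a')
    have r6 := mul_nonneg hAτ0 (integral_nonneg he0 : 0 ≤ ∫ ω, e ω ∂P)
    have r5 := mul_nonneg hAτ0 ha'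
    linarith
  · exact (((hv'.norm.pow 2).const_mul 2).add (hu'.norm.pow 2)).add
      ((hu.norm.pow 2).mono hmΩ).aestronglyMeasurable
  · filter_upwards [hle] with ω h1
    simp only [Pi.add_apply, hV, hZ, he]
    have s1 : A / τ * (hm ω ^ 2 * (1 + ‖um ω‖ ^ 2))
        = A * (1 + ‖um ω‖ ^ 2) * (hm ω ^ 2 / τ) := by ring
    have s2 : ∀ y : ℝ, 3 * A / τ * (h ω ^ 2 * y)
        = A * y * (3 * (h ω ^ 2 / τ)) := fun y => by ring
    rw [s1, s2]
    linarith

end ExpectedEnergy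

/-! ### Energy along the scheme -/

section Scheme

variable {d : ℕ} {D : Set (Rn d)} {F : H01 D → L2 D} {σ : H01 D → H01 D} {K : ℝ}
  {Ω : Type*} {mΩ : MeasurableSpace Ω} {P : Measure Ω}
  {T : ℝ≥0} {N : ℕ} {𝓕 : Filtration ℝ≥0 mΩ} {W : ℝ≥0 → Ω → ℝ}

/-- The second equation, with the gradient terms completed to inner products of `H¹₀(D)`. -/
lemma SecondEq.inner_eq {θ τ dW hW : ℝ} {um u u' : H01 D} {v v' : L2 D}
    (h : SecondEq θ τ F σ dW hW um u u' v v') : ∃ w : H01 D, (θ ≠ 0 → toL2 w = v) ∧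
    ∀ φ : H01 D, inner ℝ (v' - v) (toL2 φ)
        + τ * inner ℝ ((1 - θ) • u' + θ • um) φ =
      τ * inner ℝ ((1 - θ) • F u' + θ • F um + toL2L D ((1 - θ) • u' + θ • um)) (toL2 φ)
        + dW * inner ℝ (toL2 (σ u)) (toL2 φ)
        + 2 * θ * hW * inner ℝ (toL2 (lineDeriv ℝ σ u w)) (toL2 φ) := by
  obtain ⟨w, hw, h⟩ := h
  refine ⟨w, hw, fun φ => ?_⟩
  have h1 := h φ
  have h2 : inner ℝ ((1 - θ) • u' + θ • um) φ = inner ℝ (toL2L D ((1 - θ) • u' + θ • um)) (toL2 φ)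
      + inner ℝ ((1 - θ) • grad u' + θ • grad um) (grad φ) := inner_H01 _ φ
  rw [real_inner_smul_left (toL2 (σ u)), real_inner_smul_left (toL2 _)] at h1
  rw [h2, inner_add_left ((1 - θ) • F u' + θ • F um)]
  linear_combination h1

set_option maxHeartbeats 1000000 in
/-- The pathwise energy inequality for one step of the implicit scheme. -/
lemma pathwise_energy_step_zero (hD : IsOpen D) (hg : LinearGrowth F σ K) {τ dW hW : ℝ}
    (hτ : 0 < τ) {um u u' : H01 D} {v v' : L2 D} (h1 : FirstEq τ σ hW u u' v')
    (h2 : SecondEq 0 τ F σ dW hW um u u' v v') :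
    ‖v'‖ ^ 2 + ‖u'‖ ^ 2 ≤ ‖v‖ ^ 2 + ‖u‖ ^ 2 - 2 * (hW * inner ℝ u (σ u))
      + 2 * (dW * inner ℝ (toL2L D (σ u)) v)
      + growthConst K * (hW ^ 2 + dW ^ 2) * (1 + ‖u‖ ^ 2)
      + 5 * growthConst K * τ * (1 + ‖v'‖ ^ 2 + ‖u'‖ ^ 2) := by
  have hw := h1.toL2_eq hD hτ
  obtain ⟨_, _, h3⟩ := h2.inner_eq
  obtain ⟨w', hw'⟩ : ∃ w', w' = τ⁻¹ • (u' - u + hW • σ u) := ⟨_, rfl⟩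
  rw [← hw'] at hw
  have hw2 : τ • w' = u' - u + hW • σ u := by
    rw [hw', smul_smul, mul_inv_cancel₀ hτ.ne', one_smul]
  have hJ : toL2L D w' = v' := hw
  have := energy_step_zero (toL2L D) norm_toL2L_le (dW := dW) (v := v) (f := F u') hτ
    (one_le_growthConst K) hw2 (hg.norm_sigma_sq_le u) (hg.norm_F_sq_le u') fun φ => by
      have h4 := h3 φ
      simp only [sub_zero, one_smul, zero_smul, add_zero, mul_zero, zero_mul] at h4
      rw [hJ]
      exact h4
  rwa [hJ] at this

set_option maxHeartbeats 1000000 in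
/-- The pathwise energy inequality for one step of the scheme with `θ = 1/2`; `hm` is the noise of
the previous step. -/
lemma pathwise_energy_step_half (hD : IsOpen D) (hg : LinearGrowth F σ K)
    (hl : LipschitzBound F σ K) {τ dW hW hm : ℝ} (hτ : 0 < τ) (hτ1 : τ ≤ 1) {um u u' : H01 D}
    {v v' : L2 D} (h0 : FirstEq τ σ hm um u v) (h1 : FirstEq τ σ hW u u' v')
    (h2 : SecondEq (1 / 2) τ F σ dW hW um u u' v v') :
    2 * ‖v'‖ ^ 2 + ‖u'‖ ^ 2 + ‖u‖ ^ 2 ≤ 2 * ‖v‖ ^ 2 + ‖u‖ ^ 2 + ‖um‖ ^ 2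
      + 4 * (dW * inner ℝ (toL2L D (σ u)) v)
      + growthConst K * (1 + (2 * ‖v‖ ^ 2 + ‖u‖ ^ 2 + ‖um‖ ^ 2)) * (3 * (hW ^ 2 / τ) + 4 * dW ^ 2)
      + growthConst K * (1 + ‖um‖ ^ 2) * (hm ^ 2 / τ)
      + 15 * growthConst K * τ * (2 + (2 * ‖v‖ ^ 2 + ‖u‖ ^ 2 + ‖um‖ ^ 2)
          + (2 * ‖v'‖ ^ 2 + ‖u'‖ ^ 2 + ‖u‖ ^ 2)) := by
  have hw := h0.toL2_eq hD hτ
  have hw' := h1.toL2_eq hD hτ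
  obtain ⟨w₀, hw₀, h3⟩ := h2.inner_eq
  have hc : ∀ x : H01 D, τ • (τ⁻¹ • x) = x := fun x => by
    rw [smul_smul, mul_inv_cancel₀ hτ.ne', one_smul]
  obtain ⟨w, hwdef⟩ : ∃ w, w = τ⁻¹ • (u - um + hm • σ um) := ⟨_, rfl⟩
  obtain ⟨w', hwdef'⟩ : ∃ w', w' = τ⁻¹ • (u' - u + hW • σ u) := ⟨_, rfl⟩
  rw [← hwdef] at hw
  rw [← hwdef'] at hw'
  have hJ : toL2L D w = v := hw
  have hJ' : toL2L D w' = v' := hw'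
  have hD1 := norm_toL2_lineDeriv_sq_le hg hl u w₀
  rw [hw₀ (by norm_num), ← hJ] at hD1
  have := energy_step_half (toL2L D) norm_toL2L_le (dW := dW) (h := hW) (hm := hm) (um := um)
    (u := u) (u' := u') (w := w) (w' := w') (s := σ u) (sm := σ um)
    (f := F u') (fm := F um) (Dv := toL2 (lineDeriv ℝ σ u w₀)) hτ hτ1 (one_le_growthConst K)
    (by rw [hwdef, hc]) (by rw [hwdef', hc])
    (hg.norm_sigma_sq_le u) (hg.norm_sigma_sq_le um)
    (hg.norm_F_sq_le _) (hg.norm_F_sq_le _) hD1 fun φ => by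
      have h4 := h3 φ
      have e0 : (1 : ℝ) - 1 / 2 = 1 / 2 := by norm_num
      have e1 : (1 / 2 : ℝ) • u' + (1 / 2 : ℝ) • um = (1 / 2 : ℝ) • (u' + um) :=
        (smul_add _ _ _).symm
      have e2 : (1 / 2 : ℝ) • F u' + (1 / 2 : ℝ) • F um = (1 / 2 : ℝ) • (F u' + F um) :=
        (smul_add _ _ _).symm
      rw [e0, e1, e2, map_smul, ← smul_add, real_inner_smul_left (u' + um),
        real_inner_smul_left (F u' + F um + _)] at h4
      rw [hJ, hJ', toL2L_apply φ, toL2L_apply (σ u)]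
      linear_combination h4
  rwa [hJ, hJ'] at this

/-- One step of the implicit scheme, in expectation. -/
lemma expected_energy_step_zero [IsProbabilityMeasure P] (hD : IsOpen D) (hT : 0 < T)
    (hg : LinearGrowth F σ K) (hl : LipschitzBound F σ K) (hW : IsWiener T 𝓕 W P)
    (hτ1 : (tau T N : ℝ) ≤ 1) (hAτ : 10 * growthConst K * tau T N ≤ 1)
    {u₀ : Ω → H01 D} {v₀ : Ω → L2 D} {u : ℕ → Ω → H01 D} {v : ℕ → Ω → L2 D}
    (hs : IsThetaScheme 0 0 T N F σ 𝓕 W P u₀ v₀ u v) {n : ℕ} (hn : n < N)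
    (hi : Integrable (fun ω => ‖v n ω‖ ^ 2 + ‖u n ω‖ ^ 2) P) :
    Integrable (fun ω => ‖v (n + 1) ω‖ ^ 2 + ‖u (n + 1) ω‖ ^ 2) P ∧
      ∫ ω, ‖v (n + 1) ω‖ ^ 2 + ‖u (n + 1) ω‖ ^ 2 ∂P ≤ ∫ ω, ‖v n ω‖ ^ 2 + ‖u n ω‖ ^ 2 ∂P
        + 7 * growthConst K * tau T N * (1 + ∫ ω, ‖v n ω‖ ^ 2 + ‖u n ω‖ ^ 2 ∂P
          + ∫ ω, ‖v (n + 1) ω‖ ^ 2 + ‖u (n + 1) ω‖ ^ 2 ∂P) := by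
  have hτ := tau_pos hT (Nat.zero_lt_of_lt hn)
  have hσu : StronglyMeasurable[𝓕 (node T N n)] fun ω => σ (u n ω) :=
    hl.continuous_sigma.comp_stronglyMeasurable (hs.adapted_u n hn.le)
  refine expected_energy_le_zero hτ hτ1 (one_le_growthConst K) hAτ (𝓕.le (node T N n))
    (isNoise_incr hW hn) (isNoise_hatIncr hW hT hn) (hs.adapted_u n hn.le) (hs.adapted_v n hn.le)
    hσu ((toL2L D).continuous.comp_stronglyMeasurable hσu)
    ((hs.adapted_u (n + 1) hn).mono (𝓕.le _)).aestronglyMeasurable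
    ((hs.adapted_v (n + 1) hn).mono (𝓕.le _)).aestronglyMeasurable
    (fun ω => hg.norm_sigma_sq_le _) (fun ω => norm_toL2L_le _) hi ?_
  filter_upwards [hs.first n hn, hs.second n (Nat.zero_le n) hn] with ω h1 h2
  exact pathwise_energy_step_zero hD hg hτ h1 h2

/-- One step of the scheme with `θ = 1/2`, in expectation. -/
lemma expected_energy_step_half [IsProbabilityMeasure P] (hD : IsOpen D) (hT : 0 < T)
    (hg : LinearGrowth F σ K) (hl : LipschitzBound F σ K) (hW : IsWiener T 𝓕 W P)
    (hτ1 : (tau T N : ℝ) ≤ 1) (hAτ : 30 * growthConst K * tau T N ≤ 1)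
    {u₀ : Ω → H01 D} {v₀ : Ω → L2 D} {u : ℕ → Ω → H01 D} {v : ℕ → Ω → L2 D}
    (hs : IsThetaScheme (1 / 2) 1 T N F σ 𝓕 W P u₀ v₀ u v) {n : ℕ} (hn : n + 1 < N)
    (hi : Integrable (fun ω => 2 * ‖v (n + 1) ω‖ ^ 2 + ‖u (n + 1) ω‖ ^ 2 + ‖u n ω‖ ^ 2) P) :
    Integrable (fun ω => 2 * ‖v (n + 2) ω‖ ^ 2 + ‖u (n + 2) ω‖ ^ 2 + ‖u (n + 1) ω‖ ^ 2) P ∧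
      ∫ ω, 2 * ‖v (n + 2) ω‖ ^ 2 + ‖u (n + 2) ω‖ ^ 2 + ‖u (n + 1) ω‖ ^ 2 ∂P
      ≤ ∫ ω, 2 * ‖v (n + 1) ω‖ ^ 2 + ‖u (n + 1) ω‖ ^ 2 + ‖u n ω‖ ^ 2 ∂P
        + 38 * growthConst K * tau T N *
          (1 + ∫ ω, 2 * ‖v (n + 1) ω‖ ^ 2 + ‖u (n + 1) ω‖ ^ 2 + ‖u n ω‖ ^ 2 ∂P
          + ∫ ω, 2 * ‖v (n + 2) ω‖ ^ 2 + ‖u (n + 2) ω‖ ^ 2 + ‖u (n + 1) ω‖ ^ 2 ∂P) := by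
  have hn' : n < N := by omega
  have hτ := tau_pos hT (Nat.zero_lt_of_lt hn)
  have hσu : StronglyMeasurable[𝓕 (node T N (n + 1))] fun ω => σ (u (n + 1) ω) :=
    hl.continuous_sigma.comp_stronglyMeasurable (hs.adapted_u (n + 1) hn.le)
  refine expected_energy_le_half hτ (one_le_growthConst K) hAτ (𝓕.le (node T N (n + 1)))
    (𝓕.mono (node_mono T N n.le_succ)) (isNoise_incr hW hn) (isNoise_hatIncr hW hT hn)
    (isNoise_hatIncr hW hT hn') (hs.adapted_u n hn'.le) (hs.adapted_u (n + 1) hn.le)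
    (hs.adapted_v (n + 1) hn.le) ((toL2L D).continuous.comp_stronglyMeasurable hσu)
    ((hs.adapted_u (n + 2) hn).mono (𝓕.le _)).aestronglyMeasurable
    ((hs.adapted_v (n + 2) hn).mono (𝓕.le _)).aestronglyMeasurable
    (fun ω => (pow_le_pow_left₀ (norm_nonneg _) (norm_toL2L_le _) 2).trans
      (hg.norm_sigma_sq_le _)) hi ?_
  filter_upwards [hs.first n hn', hs.first (n + 1) hn, hs.second (n + 1) (by omega) hn]
    with ω h0 h1 h2
  exact pathwise_energy_step_half hD hg hl hτ hτ1 h0 h1 h2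

end Scheme

/-! ### The starting step of the scheme with `θ = 1/2` -/

section Start

/-- Size of the starting value, in any norm that controls all of its terms. -/
lemma norm_starting_value_sq_le {X : Type*} [NormedAddCommGroup X] [InnerProductSpace ℝ X]
    {τ dW h : ℝ} (hτ : 0 ≤ τ) (hτ1 : τ ≤ 1) {x v u l f s : X}
    (hx : x = τ • v + u - (τ ^ 2 / 2) • l - (τ ^ 2 / 2) • f - h • s + (τ * dW) • s) :
    ‖x‖ ^ 2 ≤ 4 * (‖v‖ ^ 2 + ‖u‖ ^ 2 + ‖l‖ ^ 2 + ‖f‖ ^ 2) + 8 * (h ^ 2 + dW ^ 2) * ‖s‖ ^ 2 := by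
  have hx' : x = (τ • v + u) + ((-(τ ^ 2 / 2)) • (l + f) + (τ * dW - h) • s) := by
    rw [hx]; module
  have h0 := norm_add_sq_le_two (τ • v + u) ((-(τ ^ 2 / 2)) • (l + f) + (τ * dW - h) • s)
  have h1 := norm_add_sq_le_two (τ • v) u
  have h2 := norm_add_sq_le_two ((-(τ ^ 2 / 2)) • (l + f)) ((τ * dW - h) • s)
  have h3 := norm_add_sq_le_two l f
  rw [← hx'] at h0
  simp only [norm_smul, mul_pow, Real.norm_eq_abs, sq_abs] at h1 h2
  have t1 : τ ^ 2 ≤ 1 := pow_le_one₀ hτ hτ1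
  have t2 : (-(τ ^ 2 / 2)) ^ 2 ≤ 1 / 2 := by nlinarith [sq_nonneg τ]
  have t3 : (τ * dW - h) ^ 2 ≤ 2 * (h ^ 2 + dW ^ 2) := by
    nlinarith [sq_nonneg (τ * dW + h), mul_le_mul_of_nonneg_right t1 (sq_nonneg dW)]
  have m1 := mul_le_mul_of_nonneg_right t1 (sq_nonneg ‖v‖)
  have m2 := mul_le_mul_of_nonneg_right t2 (sq_nonneg ‖l + f‖)
  have m3 := mul_le_mul_of_nonneg_right t3 (sq_nonneg ‖s‖)
  linarith

/-- Size of the first velocity. The noise `h` of order `τ ^ (3 / 2)`, which would have to be divided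
by `τ`, cancels. -/
lemma norm_first_velocity_sq_le {X : Type*} [NormedAddCommGroup X] [InnerProductSpace ℝ X]
    {τ dW h : ℝ} (hτ : 0 < τ) (hτ1 : τ ≤ 1) {x y v u l f s : X}
    (hx : x = τ • v + u - (τ ^ 2 / 2) • l - (τ ^ 2 / 2) • f - h • s + (τ * dW) • s)
    (hy : y = τ⁻¹ • (x - u + h • s)) :
    ‖y‖ ^ 2 ≤ 4 * (‖v‖ ^ 2 + ‖l‖ ^ 2 + ‖f‖ ^ 2) + 4 * dW ^ 2 * ‖s‖ ^ 2 := by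
  have hy' : y = (v + dW • s) + (-(τ / 2)) • (l + f) := by
    have : x - u + h • s = τ • ((v + dW • s) + (-(τ / 2)) • (l + f)) := by rw [hx]; module
    rw [hy, this, smul_smul, inv_mul_cancel₀ hτ.ne', one_smul]
  have h0 := norm_add_sq_le_two (v + dW • s) ((-(τ / 2)) • (l + f))
  have h1 := norm_add_sq_le_two v (dW • s)
  have h2 := norm_add_sq_le_two l f
  rw [← hy'] at h0
  simp only [norm_smul, mul_pow, Real.norm_eq_abs, sq_abs] at h0 h1
  have t2 : (-(τ / 2)) ^ 2 ≤ 1 / 2 := by nlinarith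
  have m2 := mul_le_mul_of_nonneg_right t2 (sq_nonneg ‖l + f‖)
  linarith [sq_nonneg ‖l‖, sq_nonneg ‖f‖]

variable {d : ℕ} {D : Set (Rn d)} {F : H01 D → L2 D} {σ : H01 D → H01 D} {K : ℝ}

set_option maxHeartbeats 1000000 in
/-- The energy after the starting step. Uniqueness of the weak gradient turns the `L²(D)` identity
defining `u₁` into an identity in `H¹(D)`. -/
lemma pathwise_energy_start (hD : IsOpen D) (hg : LinearGrowth F σ K) {τ dW hW : ℝ}
    (hτ : 0 < τ) (hτ1 : τ ≤ 1) {u₀ v₀ u₁ : H01 D} {v₁ : L2 D} {Lu : GraphSpace D} (hLu : IsH1 Lu)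
    (hs : StartingValue τ F σ dW hW u₀ v₀ Lu.fst u₁) (h1 : FirstEq τ σ hW u₀ u₁ v₁) :
    2 * ‖v₁‖ ^ 2 + ‖u₁‖ ^ 2 + ‖u₀‖ ^ 2 ≤
      17 * ((‖v₀‖ ^ 2 + ‖u₀‖ ^ 2 + ‖Lu‖ ^ 2) + growthConst K * (1 + ‖u₀‖ ^ 2))
      + 17 * growthConst K * (hW ^ 2 + dW ^ 2) * (1 + ‖u₀‖ ^ 2) := by
  obtain ⟨p, hp1, hp2, hp3⟩ := hg.exists_graph u₀
  have hS := hg.norm_sigma_sq_le u₀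
  have hu : (u₁ : GraphSpace D) = τ • (v₀ : GraphSpace D) + (u₀ : GraphSpace D) - (τ ^ 2 / 2) • Lu
      - (τ ^ 2 / 2) • p - hW • (σ u₀ : GraphSpace D) + (τ * dW) • (σ u₀ : GraphSpace D) := by
    have m : ∀ x : H01 D, (x : GraphSpace D) ∈ H1 D := fun x => H01_le_H1 x.2
    refine H1_ext hD (m u₁) ?_ ?_
    · exact add_mem (sub_mem (sub_mem (sub_mem (add_mem ((H1 D).smul_mem _ (m v₀)) (m u₀))
        ((H1 D).smul_mem _ hLu)) ((H1 D).smul_mem _ hp1)) ((H1 D).smul_mem _ (m _)))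
        ((H1 D).smul_mem _ (m _))
    · rw [WithLp.add_fst, WithLp.sub_fst, WithLp.sub_fst, WithLp.sub_fst, WithLp.add_fst,
        WithLp.smul_fst, WithLp.smul_fst, WithLp.smul_fst, WithLp.smul_fst, WithLp.smul_fst, hp2]
      exact hs
  have b1 := norm_starting_value_sq_le hτ.le hτ1 hu
  have hv : v₁ = τ⁻¹ • (toL2 u₁ - toL2 u₀ + hW • toL2 (σ u₀)) := (h1.toL2_eq hD hτ).symm
  have b2 := norm_first_velocity_sq_le hτ hτ1 hs hv
  have c0 : ∀ x : H01 D, ‖(x : GraphSpace D)‖ = ‖x‖ := fun x => rfl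
  rw [c0, c0, c0, c0] at b1
  have c1 : ∀ x : H01 D, ‖toL2 x‖ ^ 2 ≤ ‖x‖ ^ 2 := fun x =>
    pow_le_pow_left₀ (norm_nonneg _) (norm_toL2L_le x) 2
  have c2 := norm_fst_sq_le Lu
  have c3 := hg.norm_F_sq_le u₀
  have c4 := c1 v₀
  have c5 := mul_le_mul_of_nonneg_left ((c1 (σ u₀)).trans hS) (sq_nonneg dW)
  have c6 := mul_le_mul_of_nonneg_left hS (add_nonneg (sq_nonneg hW) (sq_nonneg dW))
  have c7 : 0 ≤ growthConst K * (1 + ‖u₀‖ ^ 2) := (sq_nonneg _).trans hS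
  have c8 := mul_nonneg (sq_nonneg hW) c7
  have c9 := mul_nonneg (sq_nonneg dW) c7
  have d1 := sq_nonneg ‖v₀‖
  have d2 := sq_nonneg ‖Lu‖
  have d3 := sq_nonneg ‖u₀‖
  generalize growthConst K = A at *
  generalize ‖v₁‖ ^ 2 = x1 at *
  generalize ‖u₁‖ ^ 2 = x2 at *
  generalize ‖u₀‖ ^ 2 = x3 at *
  generalize ‖v₀‖ ^ 2 = x4 at *
  generalize ‖Lu‖ ^ 2 = x5 at *
  linarith

variable {Ω : Type*} {mΩ : MeasurableSpace Ω} {P : Measure Ω}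

/-- A nonnegative function below an integrable function. -/
lemma expectLE_of_le {f g : Ω → ℝ} {C : ℝ} (hf : AEStronglyMeasurable f P) (hf0 : 0 ≤ f)
    (hg : Integrable g P) (hfg : f ≤ᵐ[P] g) (hC : ∫ ω, g ω ∂P ≤ C) : ExpectLE P f C := by
  have hi : Integrable f P := hg.mono' hf (by
    filter_upwards [hfg] with ω hω
    rwa [Real.norm_eq_abs, abs_of_nonneg (hf0 ω)])
  exact ⟨hi, (integral_mono_ae hi hg hfg).trans hC⟩

/-- Expectation of the energy after the starting step. -/
lemma expected_energy_start {X : Type*} [NormedAddCommGroup X] [IsProbabilityMeasure P] {A τ : ℝ}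
    (hτ : 0 < τ) (hτ1 : τ ≤ 1) (hA : 1 ≤ A) {m : MeasurableSpace Ω} {dW h : Ω → ℝ}
    (hnd : IsNoise P m dW τ) (hnh : IsNoise P m h (τ ^ 3)) {u : Ω → X}
    (hu : StronglyMeasurable[m] u) {S e : Ω → ℝ} (hS : Integrable S P)
    (hui : Integrable (fun ω => ‖u ω‖ ^ 2) P) (huS : ∀ᵐ ω ∂P, ‖u ω‖ ^ 2 ≤ S ω)
    (he : AEStronglyMeasurable[mΩ] e P) (he0 : 0 ≤ e)
    (hle : ∀ᵐ ω ∂P, e ω ≤ 17 * (S ω + A * (1 + ‖u ω‖ ^ 2))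
      + 17 * A * (h ω ^ 2 + dW ω ^ 2) * (1 + ‖u ω‖ ^ 2)) :
    ExpectLE P e (17 * (∫ ω, S ω ∂P + 3 * A * (1 + ∫ ω, S ω ∂P))) := by
  set Y : Ω → ℝ := fun ω => 1 + ‖u ω‖ ^ 2 with hY
  have hYm : StronglyMeasurable[m] Y := stronglyMeasurable_const.add (hu.norm.pow 2)
  have hYi : Integrable Y P := (integrable_const 1).add hui
  have hY0 : 0 ≤ Y := fun ω => by positivity
  have i1 := hS.const_mul 17
  have i2 := hYi.const_mul (17 * A)
  have i3 := (hnh.integrable_sq_mul _ hYm hYi).const_mul (17 * A)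
  have i4 := (hnd.integrable_sq_mul _ hYm hYi).const_mul (17 * A)
  refine expectLE_of_le he he0 (((i1.add i2).add i3).add i4) ?_ ?_
  · filter_upwards [hle] with ω h1
    simp only [Pi.add_apply, hY]
    linarith
  · rw [integral_add' ((i1.add i2).add i3) i4, integral_add' (i1.add i2) i3, integral_add' i1 i2,
      integral_const_mul, integral_const_mul, integral_const_mul, integral_const_mul]
    have q1 := hnh.integral_sq_mul_le _ hYm hYi hY0
    have q2 := hnd.integral_sq_mul_le _ hYm hYi hY0
    have q0 : 0 ≤ ∫ ω, Y ω ∂P := integral_nonneg hY0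
    have q3 : ∫ ω, Y ω ∂P ≤ 1 + ∫ ω, S ω ∂P := by
      rw [hY, integral_add (integrable_const 1) hui, integral_const, probReal_univ, one_smul]
      linarith [integral_mono_ae hui hS huS]
    set y := ∫ ω, Y ω ∂P
    have t1 : τ ^ 3 * y ≤ 1 * y :=
      mul_le_mul_of_nonneg_right (pow_le_one₀ hτ.le hτ1) q0
    have t2 : τ * y ≤ 1 * y := mul_le_mul_of_nonneg_right hτ1 q0
    have A0 : 0 ≤ A := by linarith
    have r1 := mul_le_mul_of_nonneg_left (q1.trans t1) A0
    have r2 := mul_le_mul_of_nonneg_left (q2.trans t2) A0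
    have r3 := mul_le_mul_of_nonneg_left q3 A0
    linarith

end Start

/-! ### Uniform energy bounds -/

section Bounds

variable {d : ℕ} {D : Set (Rn d)} {F : H01 D → L2 D} {σ : H01 D → H01 D} {K : ℝ}
  {Ω : Type*} {mΩ : MeasurableSpace Ω} {P : Measure Ω}
  {T : ℝ≥0} {N : ℕ} {𝓕 : Filtration ℝ≥0 mΩ} {W : ℝ≥0 → Ω → ℝ}

/-- The threshold for the number of steps. It makes the time step at most `1` and so small that the
one-step inequalities can be solved for the new energy: `76 = 2 * 38`, where `38` is the larger of
the two constants in the one-step inequalities. -/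
noncomputable def minSteps (T : ℝ≥0) (K : ℝ) : ℕ := ⌈76 * growthConst K * T⌉₊ + 1

lemma tau_small (hN : minSteps T K ≤ N) :
    0 < N ∧ (tau T N : ℝ) ≤ 1 ∧ 76 * growthConst K * tau T N ≤ 1 := by
  have hN0 : 0 < N := lt_of_lt_of_le (Nat.succ_pos _) hN
  have hA := one_le_growthConst K
  have h1 : 76 * growthConst K * T ≤ N := by
    refine (Nat.le_ceil _).trans ?_
    exact_mod_cast (Nat.le_succ _).trans hN
  have hNr : (0 : ℝ) < N := by exact_mod_cast hN0
  have h2 : 76 * growthConst K * tau T N ≤ 1 := by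
    rw [← mul_tau T hN0] at h1
    refine le_of_mul_le_mul_left (a := (N : ℝ)) ?_ hNr
    linarith
  refine ⟨hN0, ?_, h2⟩
  have h3 : (0 : ℝ) ≤ tau T N := NNReal.coe_nonneg _
  nlinarith

/-- The discrete time derivative, expressed by the velocity and the noise. -/
lemma norm_discrete_deriv_sq_le (hD : IsOpen D) (hg : LinearGrowth F σ K) {τ hW : ℝ} (hτ : 0 < τ)
    {u u' : H01 D} {v' : L2 D} (h1 : FirstEq τ σ hW u u' v') :
    ‖τ⁻¹ • (toL2 u' - toL2 u)‖ ^ 2 ≤ 2 * ‖v'‖ ^ 2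
      + 2 * growthConst K / τ ^ 2 * (hW ^ 2 * (1 + ‖u‖ ^ 2)) := by
  have h2 := h1.toL2_eq hD hτ
  have h3 : toL2 (τ⁻¹ • (u' - u + hW • σ u)) = τ⁻¹ • (toL2 u' - toL2 u + hW • toL2 (σ u)) := rfl
  have h4 : τ⁻¹ • (toL2 u' - toL2 u) = v' + (-(τ⁻¹ * hW)) • toL2 (σ u) := by
    rw [← h2, h3, smul_add, smul_smul, neg_smul, add_neg_cancel_right]
  have h5 := norm_add_sq_le_two v' ((-(τ⁻¹ * hW)) • toL2 (σ u))
  rw [← h4] at h5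
  refine h5.trans ?_
  rw [norm_smul, mul_pow, Real.norm_eq_abs, sq_abs]
  have h6 : ‖toL2 (σ u)‖ ^ 2 ≤ growthConst K * (1 + ‖u‖ ^ 2) :=
    (pow_le_pow_left₀ (norm_nonneg _) (norm_toL2L_le (σ u)) 2).trans (hg.norm_sigma_sq_le u)
  have h7 := mul_le_mul_of_nonneg_left h6 (sq_nonneg (-(τ⁻¹ * hW)))
  have h8 : 2 * growthConst K / τ ^ 2 * (hW ^ 2 * (1 + ‖u‖ ^ 2))
      = 2 * ((-(τ⁻¹ * hW)) ^ 2 * (growthConst K * (1 + ‖u‖ ^ 2))) := by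
    rw [neg_sq, mul_pow, inv_pow]; ring
  linarith

/-- The energy of the implicit scheme, uniformly in the number of steps. -/
lemma expected_energy_zero_le [IsProbabilityMeasure P] (hD : IsOpen D) (hT : 0 < T)
    (hg : LinearGrowth F σ K) (hl : LipschitzBound F σ K) (hW : IsWiener T 𝓕 W P)
    (hN : minSteps T K ≤ N)
    {u₀ : Ω → H01 D} {v₀ : Ω → L2 D} {u : ℕ → Ω → H01 D} {v : ℕ → Ω → L2 D}
    (hu₀ : MemLp u₀ 2 P) (hv₀ : MemLp v₀ 2 P)
    (hs : IsThetaScheme 0 0 T N F σ 𝓕 W P u₀ v₀ u v) {n : ℕ} (hn : n ≤ N) :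
    ExpectLE P (fun ω => ‖v n ω‖ ^ 2 + ‖u n ω‖ ^ 2)
      (Real.exp (4 * (7 * growthConst K) * T) * (∫ ω, ‖v₀ ω‖ ^ 2 + ‖u₀ ω‖ ^ 2 ∂P + 1)) := by
  obtain ⟨hN0, hτ1, hAτ⟩ := tau_small hN
  have hA := one_le_growthConst K
  have hτ := tau_pos hT hN0
  have hAτ0 : 0 ≤ growthConst K * tau T N := by positivity
  have h0 : (fun ω => ‖v₀ ω‖ ^ 2 + ‖u₀ ω‖ ^ 2) =ᵐ[P] fun ω => ‖v 0 ω‖ ^ 2 + ‖u 0 ω‖ ^ 2 := by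
    filter_upwards [hs.init_u, hs.init_v] with ω h1 h2
    rw [h1, h2]
  have hi0 : Integrable (fun ω => ‖v₀ ω‖ ^ 2 + ‖u₀ ω‖ ^ 2) P :=
    ((memLp_two_iff_integrable_sq_norm hv₀.1).1 hv₀).add
      ((memLp_two_iff_integrable_sq_norm hu₀.1).1 hu₀)
  have hstep := fun n (hn : n < N) => expected_energy_step_zero hD hT hg hl hW hτ1
    (by linarith) hs hn
  have hi : ∀ n ≤ N, Integrable (fun ω => ‖v n ω‖ ^ 2 + ‖u n ω‖ ^ 2) P := by
    intro n
    induction n with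
    | zero => intro _; exact hi0.congr h0
    | succ n ih => intro hn; exact (hstep n hn (ih (by omega))).1
  refine ⟨hi n hn, ?_⟩
  have := discrete_gronwall (a := fun n => ∫ ω, ‖v n ω‖ ^ 2 + ‖u n ω‖ ^ 2 ∂P)
    (c := 7 * growthConst K) (τ := tau T N) (N := N)
    (fun n => integral_nonneg fun ω => by positivity) (by linarith) hτ.le (by linarith)
    (fun n hn => (hstep n hn (hi n hn.le)).2) hn
  rw [mul_tau T hN0, ← integral_congr_ae h0] at this
  linarith

/-- The energy of the scheme with `θ = 1/2`, uniformly in the number of steps. -/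
lemma expected_energy_half_le [IsProbabilityMeasure P] (hD : IsOpen D) (hT : 0 < T)
    (hg : LinearGrowth F σ K) (hl : LipschitzBound F σ K) (hW : IsWiener T 𝓕 W P)
    (hN : minSteps T K ≤ N)
    {u₀ v₀ : Ω → H01 D} {Lu₀ : Ω → GraphSpace D} {u : ℕ → Ω → H01 D} {v : ℕ → Ω → L2 D}
    (hu₀ : MemLp u₀ 2 P) (hv₀ : MemLp v₀ 2 P) (hLu : MemLp Lu₀ 2 P)
    (hH1 : ∀ᵐ ω ∂P, IsH1 (Lu₀ ω))
    (hs : IsThetaScheme (1 / 2) 1 T N F σ 𝓕 W P u₀ (fun ω => toL2 (v₀ ω)) u v)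
    (hstart : ∀ᵐ ω ∂P, StartingValue (tau T N) F σ (incr W T N 0 ω) (hatIncr W T N 0 ω)
      (u₀ ω) (v₀ ω) (Lu₀ ω).fst (u 1 ω)) {M : ℝ}
    (hM : M = ∫ ω, ‖v₀ ω‖ ^ 2 + ‖u₀ ω‖ ^ 2 + ‖Lu₀ ω‖ ^ 2 ∂P) {n : ℕ} (hn : n + 1 ≤ N) :
    ExpectLE P (fun ω => 2 * ‖v (n + 1) ω‖ ^ 2 + ‖u (n + 1) ω‖ ^ 2 + ‖u n ω‖ ^ 2)
      (Real.exp (4 * (38 * growthConst K) * T)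
        * (17 * (M + 3 * growthConst K * (1 + M)) + 1)) := by
  obtain ⟨hN0, hτ1, hAτ⟩ := tau_small hN
  have hA := one_le_growthConst K
  have hτ := tau_pos hT hN0
  have hAτ0 : 0 ≤ growthConst K * tau T N := by positivity
  have iu := (memLp_two_iff_integrable_sq_norm hu₀.1).1 hu₀
  have iv := (memLp_two_iff_integrable_sq_norm hv₀.1).1 hv₀
  have iL := (memLp_two_iff_integrable_sq_norm hLu.1).1 hLu
  have h0 := expected_energy_start (P := P) hτ hτ1 hA (isNoise_incr hW hN0)
    (isNoise_hatIncr hW hT hN0) (hs.adapted_u 0 hN0.le) ((iv.add iu).add iL)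
    (iu.congr (by filter_upwards [hs.init_u] with ω h1; rw [h1]))
    (by
      filter_upwards [hs.init_u] with ω h1
      simp only [Pi.add_apply]
      rw [h1]
      linarith [sq_nonneg ‖v₀ ω‖, sq_nonneg ‖Lu₀ ω‖])
    (e := fun ω => 2 * ‖v 1 ω‖ ^ 2 + ‖u 1 ω‖ ^ 2 + ‖u 0 ω‖ ^ 2)
    (((((hs.adapted_v 1 hN0).mono (𝓕.le _)).norm.pow 2).const_mul 2).add
      (((hs.adapted_u 1 hN0).mono (𝓕.le _)).norm.pow 2) |>.add
      (((hs.adapted_u 0 hN0.le).mono (𝓕.le _)).norm.pow 2)).aestronglyMeasurable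
    (fun ω => by positivity)
    (by
      filter_upwards [hs.init_u, hs.first 0 hN0, hstart, hH1] with ω h1 h2 h3 h4
      rw [h1] at h2 ⊢
      exact pathwise_energy_start hD hg hτ hτ1 h4 h3 h2)
  have hM' : M = ∫ ω, (((fun ω => ‖v₀ ω‖ ^ 2) + fun ω => ‖u₀ ω‖ ^ 2)
      + fun ω => ‖Lu₀ ω‖ ^ 2) ω ∂P := hM
  rw [← hM'] at h0
  have hstep := fun n (hn : n + 1 < N) => expected_energy_step_half hD hT hg hl hW hτ1
    (by linarith) hs hn
  have hi : ∀ n, n + 1 ≤ N →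
      Integrable (fun ω => 2 * ‖v (n + 1) ω‖ ^ 2 + ‖u (n + 1) ω‖ ^ 2 + ‖u n ω‖ ^ 2) P := by
    intro n
    induction n with
    | zero => intro _; exact h0.1
    | succ n ih => intro hn; exact (hstep n hn (ih (by omega))).1
  refine ⟨hi n hn, ?_⟩
  have := discrete_gronwall
    (a := fun n => ∫ ω, 2 * ‖v (n + 1) ω‖ ^ 2 + ‖u (n + 1) ω‖ ^ 2 + ‖u n ω‖ ^ 2 ∂P)
    (c := 38 * growthConst K) (τ := tau T N) (N := N - 1)
    (fun n => integral_nonneg fun ω => by positivity) (by linarith) hτ.le (by linarith)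
    (fun n hn => (hstep n (by omega) (hi n (by omega))).2) (n := n) (by omega)
  have hexp : Real.exp (4 * (38 * growthConst K) * ((N - 1 : ℕ) * tau T N))
      ≤ Real.exp (4 * (38 * growthConst K) * T) := by
    refine Real.exp_le_exp.2 (mul_le_mul_of_nonneg_left ?_ (by positivity))
    rw [← mul_tau T hN0]
    gcongr
    exact Nat.sub_le _ _
  have h00 : 0 ≤ ∫ ω, 2 * ‖v (0 + 1) ω‖ ^ 2 + ‖u (0 + 1) ω‖ ^ 2 + ‖u 0 ω‖ ^ 2 ∂P :=
    integral_nonneg fun ω => by positivity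
  have h01 : ∫ ω, 2 * ‖v (0 + 1) ω‖ ^ 2 + ‖u (0 + 1) ω‖ ^ 2 + ‖u 0 ω‖ ^ 2 ∂P
      ≤ 17 * (M + 3 * growthConst K * (1 + M)) := h0.2
  have := this.trans (mul_le_mul hexp (add_le_add_left h01 1) (by linarith) (Real.exp_pos _).le)
  linarith

lemma norm_grad_sq_le (x : H01 D) : ‖grad x‖ ^ 2 ≤ ‖x‖ ^ 2 := by
  rw [norm_sq_H01]
  exact le_add_of_nonneg_left (sq_nonneg _)

lemma stronglyMeasurable_norm_grad_sq {m : MeasurableSpace Ω} {x : Ω → H01 D}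
    (hx : StronglyMeasurable[m] x) : StronglyMeasurable[m] fun ω => ‖grad (x ω)‖ ^ 2 :=
  (continuous_grad.comp_stronglyMeasurable hx).norm.pow 2

lemma stronglyMeasurable_norm_toL2_sub_sq {m : MeasurableSpace Ω} {x y : Ω → H01 D} (c : ℝ)
    (hx : StronglyMeasurable[m] x) (hy : StronglyMeasurable[m] y) :
    StronglyMeasurable[m] fun ω => ‖c • (toL2 (x ω) - toL2 (y ω))‖ ^ 2 :=
  ((((toL2L D).continuous.comp_stronglyMeasurable hx).sub
    ((toL2L D).continuous.comp_stronglyMeasurable hy)).const_smul c).norm.pow 2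

/-- The discrete time derivative together with the energy, for the implicit scheme. -/
lemma expected_deriv_zero_le [IsProbabilityMeasure P] (hD : IsOpen D) (hT : 0 < T)
    (hg : LinearGrowth F σ K) (hW : IsWiener T 𝓕 W P) (hN : minSteps T K ≤ N)
    {u₀ : Ω → H01 D} {v₀ : Ω → L2 D} {u : ℕ → Ω → H01 D} {v : ℕ → Ω → L2 D}
    (hs : IsThetaScheme 0 0 T N F σ 𝓕 W P u₀ v₀ u v) {G : ℝ}
    (he : ∀ n ≤ N, ExpectLE P (fun ω => ‖v n ω‖ ^ 2 + ‖u n ω‖ ^ 2) G) {n : ℕ} (hn : n < N) :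
    ExpectLE P (fun ω => ‖(tau T N : ℝ)⁻¹ • (toL2 (u (n + 1) ω) - toL2 (u n ω))‖ ^ 2
      + ‖grad (u n ω)‖ ^ 2 + ‖v n ω‖ ^ 2) (2 * G + 2 * growthConst K * (1 + G) + G) := by
  obtain ⟨hN0, hτ1, -⟩ := tau_small hN
  have hτ := tau_pos hT hN0
  have hA := one_le_growthConst K
  have mu := fun n (hn : n ≤ N) => (hs.adapted_u n hn).mono (𝓕.le _)
  have hnh := isNoise_hatIncr hW hT hn
  set Y : Ω → ℝ := fun ω => 1 + ‖u n ω‖ ^ 2 with hY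
  have hYm : StronglyMeasurable[𝓕 (node T N n)] Y :=
    stronglyMeasurable_const.add ((hs.adapted_u n hn.le).norm.pow 2)
  have hun : Integrable (fun ω => ‖u n ω‖ ^ 2) P :=
    (he n hn.le).1.mono' ((mu n hn.le).norm.pow 2).aestronglyMeasurable
      (ae_of_all _ fun ω => by
        rw [Real.norm_eq_abs, abs_of_nonneg (sq_nonneg _)]; linarith [sq_nonneg ‖v n ω‖])
  have hYi : Integrable Y P := (integrable_const 1).add hun
  have hY0 : 0 ≤ Y := fun ω => by positivity
  have hG0 : 0 ≤ G := (integral_nonneg fun ω => by positivity).trans (he n hn.le).2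
  have i1 := (he (n + 1) hn).1.const_mul 2
  have i2 := (hnh.integrable_sq_mul _ hYm hYi).const_mul (2 * growthConst K / (tau T N : ℝ) ^ 2)
  refine expectLE_of_le ?_ (fun ω => by positivity) ((i1.add i2).add (he n hn.le).1) ?_ ?_
  · exact ((stronglyMeasurable_norm_toL2_sub_sq _ (mu (n + 1) hn) (mu n hn.le)).add
      (stronglyMeasurable_norm_grad_sq (mu n hn.le)) |>.add
      (((hs.adapted_v n hn.le).mono (𝓕.le _)).norm.pow 2)).aestronglyMeasurable
  · filter_upwards [hs.first n hn] with ω h1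
    have h2 := norm_discrete_deriv_sq_le hD hg hτ h1
    have h3 := norm_grad_sq_le (u n ω)
    have h4 := sq_nonneg ‖u (n + 1) ω‖
    simp only [Pi.add_apply, hY]
    linarith
  · rw [integral_add' (i1.add i2) (he n hn.le).1, integral_add' i1 i2, integral_const_mul,
      integral_const_mul]
    have q1 := hnh.integral_sq_mul_le _ hYm hYi hY0
    have q2 : ∫ ω, Y ω ∂P ≤ 1 + G := by
      rw [hY, integral_add (integrable_const 1) hun, integral_const, probReal_univ, one_smul]
      have := integral_mono hun (he n hn.le).1 fun ω => le_add_of_nonneg_left (sq_nonneg _)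
      linarith [(he n hn.le).2]
    have q3 : 2 * growthConst K / (tau T N : ℝ) ^ 2 * ∫ ω, hatIncr W T N n ω ^ 2 * Y ω ∂P
        ≤ 2 * growthConst K * (1 + G) := by
      calc 2 * growthConst K / (tau T N : ℝ) ^ 2 * ∫ ω, hatIncr W T N n ω ^ 2 * Y ω ∂P
          ≤ 2 * growthConst K / (tau T N : ℝ) ^ 2 * ((tau T N : ℝ) ^ 3 * (1 + G)) := by
            gcongr
            exact q1.trans (by gcongr)
        _ = 2 * growthConst K * (1 + G) * tau T N := by field_simp
        _ ≤ _ := mul_le_of_le_one_right (by positivity) hτ1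
    linarith [(he n hn.le).2, (he (n + 1) hn).2]

end Bounds

end StochWave

open StochWave
theorem lemma3p1 (d : ℕ) (hd1 : 1 ≤ d) (hd3 : d ≤ 3) (D : Set (Rn d)) (hDo : IsOpen D)
    (hDb : Bornology.IsBounded D) (T : ℝ≥0) (hT : 0 < T) (K : ℝ) :
    ∃ N₀ : ℕ, 1 ≤ N₀ ∧
      ∀ (Ω : Type*) (mΩ : MeasurableSpace Ω) (P : Measure Ω), IsProbabilityMeasure P →
      -- `θ = 0`
      (∀ (u₀ : Ω → H01 D) (v₀ : Ω → L2 D), MemLp u₀ 2 P → MemLp v₀ 2 P →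
        ∃ C > 0, ∀ (F : H01 D → L2 D) (σ : H01 D → H01 D),
          LinearGrowth F σ K → LipschitzBound F σ K → BoundedDerivatives F σ K →
          ∀ (𝓕 : Filtration ℝ≥0 mΩ) (W : ℝ≥0 → Ω → ℝ), IsWiener T 𝓕 W P →
          ∀ N ≥ N₀, ∀ (u : ℕ → Ω → H01 D) (v : ℕ → Ω → L2 D),
            IsThetaScheme 0 0 T N F σ 𝓕 W P u₀ v₀ u v →
            (∀ n < N, ExpectLE P (fun ω => ‖(tau T N : ℝ)⁻¹ • (toL2 (u (n + 1) ω) - toL2 (u n ω))‖ ^ 2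
                + ‖grad (u n ω)‖ ^ 2 + ‖v n ω‖ ^ 2) C) ∧
            (∀ n ≤ N, ExpectLE P (fun ω => ‖grad (u n ω)‖ ^ 2 + ‖v n ω‖ ^ 2) C)) ∧
      -- `θ = 1/2`; `Lu₀` is the graph `(Δu₀, ∇Δu₀)`
      (∀ (u₀ v₀ : Ω → H01 D) (Lu₀ : Ω → GraphSpace D), MemLp u₀ 2 P → MemLp v₀ 2 P →
        MemLp Lu₀ 2 P → (∀ᵐ ω ∂P, IsH1 (Lu₀ ω) ∧ IsWeakLaplacian (u₀ ω) (Lu₀ ω).fst) →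
        ∃ C > 0, ∀ (F : H01 D → L2 D) (σ : H01 D → H01 D),
          LinearGrowth F σ K → LipschitzBound F σ K → BoundedDerivatives F σ K →
          ∀ (𝓕 : Filtration ℝ≥0 mΩ) (W : ℝ≥0 → Ω → ℝ), IsWiener T 𝓕 W P →
          ∀ N ≥ N₀, ∀ (u : ℕ → Ω → H01 D) (v : ℕ → Ω → L2 D),
            IsThetaScheme (1 / 2) 1 T N F σ 𝓕 W P u₀ (fun ω => toL2 (v₀ ω)) u v →
            (∀ᵐ ω ∂P, StartingValue (tau T N) F σ (incr W T N 0 ω) (hatIncr W T N 0 ω)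
              (u₀ ω) (v₀ ω) (Lu₀ ω).fst (u 1 ω)) →
            ∀ n ≤ N, ExpectLE P (fun ω => ‖grad (u n ω)‖ ^ 2 + ‖v n ω‖ ^ 2) C) := by
  have hA := one_le_growthConst K
  refine ⟨minSteps T K, Nat.le_add_left _ _, fun Ω mΩ P _ => ⟨?_, ?_⟩⟩
  · intro u₀ v₀ hu₀ hv₀
    set G : ℝ := Real.exp (4 * (7 * growthConst K) * T)
      * (∫ ω, ‖v₀ ω‖ ^ 2 + ‖u₀ ω‖ ^ 2 ∂P + 1) with hG
    have hM : 0 ≤ ∫ ω, ‖v₀ ω‖ ^ 2 + ‖u₀ ω‖ ^ 2 ∂P := integral_nonneg fun ω => by positivity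
    have hG0 : 0 < G := by positivity
    have hC : 0 < 2 * G + 2 * growthConst K * (1 + G) + G := by positivity
    have hGC : G ≤ 2 * G + 2 * growthConst K * (1 + G) + G := by
      have : 0 ≤ growthConst K * (1 + G) := by positivity
      linarith
    refine ⟨_, hC, fun F σ hg hl _ 𝓕 W hW N hN u v hs => ?_⟩
    have he := fun n (hn : n ≤ N) =>
      expected_energy_zero_le (n := n) hDo hT hg hl hW hN hu₀ hv₀ hs hn
    refine ⟨fun n hn => expected_deriv_zero_le hDo hT hg hW hN hs he hn, fun n hn => ?_⟩
    exact expectLE_of_le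
      ((stronglyMeasurable_norm_grad_sq ((hs.adapted_u n hn).mono (𝓕.le _))).add
        (((hs.adapted_v n hn).mono (𝓕.le _)).norm.pow 2)).aestronglyMeasurable
      (fun ω => by positivity) (he n hn).1
      (ae_of_all _ fun ω => by have := norm_grad_sq_le (u n ω); simp only; linarith)
      ((he n hn).2.trans hGC)
  · intro u₀ v₀ Lu₀ hu₀ hv₀ hLu hLap
    obtain ⟨M, hM⟩ : ∃ M, M = ∫ ω, ‖v₀ ω‖ ^ 2 + ‖u₀ ω‖ ^ 2 + ‖Lu₀ ω‖ ^ 2 ∂P := ⟨_, rfl⟩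
    have hM0 : 0 ≤ M := by rw [hM]; exact integral_nonneg fun ω => by positivity
    set G : ℝ := Real.exp (4 * (38 * growthConst K) * T)
      * (17 * (M + 3 * growthConst K * (1 + M)) + 1) with hG
    have hG0 : 0 < G := by positivity
    refine ⟨G + M, by positivity, fun F σ hg hl _ 𝓕 W hW N hN u v hs hstart n hn => ?_⟩
    have mg : StronglyMeasurable[mΩ] fun ω => ‖grad (u n ω)‖ ^ 2 + ‖v n ω‖ ^ 2 :=
      (stronglyMeasurable_norm_grad_sq ((hs.adapted_u n hn).mono (𝓕.le _))).add
        (((hs.adapted_v n hn).mono (𝓕.le _)).norm.pow 2)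
    rcases n with _ | n
    · have iu := (memLp_two_iff_integrable_sq_norm hu₀.1).1 hu₀
      have iv := (memLp_two_iff_integrable_sq_norm hv₀.1).1 hv₀
      have iL := (memLp_two_iff_integrable_sq_norm hLu.1).1 hLu
      refine expectLE_of_le mg.aestronglyMeasurable (fun ω => by positivity) ((iv.add iu).add iL)
        ?_ ?_
      · filter_upwards [hs.init_u, hs.init_v] with ω h1 h2
        simp only [Pi.add_apply]
        rw [h1, h2]
        have := pow_le_pow_left₀ (norm_nonneg _) (norm_toL2L_le (v₀ ω)) 2
        rw [toL2L_apply] at this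
        linarith [norm_grad_sq_le (u₀ ω), sq_nonneg ‖Lu₀ ω‖]
      · calc _ = M := hM.symm
          _ ≤ G + M := by linarith
    · have he := expected_energy_half_le hDo hT hg hl hW hN hu₀ hv₀ hLu
        (hLap.mono fun ω h => h.1) hs hstart hM hn
      refine expectLE_of_le mg.aestronglyMeasurable (fun ω => by positivity) he.1
        (ae_of_all _ fun ω => ?_) (he.2.trans (by linarith))
      simp only
      linarith [norm_grad_sq_le (u (n + 1) ω), sq_nonneg ‖v (n + 1) ω‖, sq_nonneg ‖u n ω‖]
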